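/- **Setting.** Minkowski space is $\mathbb R^4$ with the Lorentz metric $g=\mathrm{diag}(1,-1,-1,-1)$ and $\Box=\partial^\mu\partial_\mu$. Let $Z\colon\mathbb R\to\mathbb R^4$ be a smooth future-directed world line parametrized by eigentime, i.e. $\dot Z_\mu\dot Z^\mu=1$ and $\dot Z^0>0$. Let $M$ be the open set of all $X\in\mathbb R^4$ for which there is a $\tau\in\mathbb R$ such that $X-Z(\tau)$ is a future-directed null vector (null, with positive time component). For $X \in M$ this $\tau$ is unique; it is the retarded proper time $\tau_r(X)$. (If for every $X\in\mathbb R^4$ there is a $\tau$ such that $X-Z(\tau)$ is null or zero with non-negative time component, then $M=\mathbb R^4\setminus Z(\mathbb R)$.) On $M$ put $$\widetilde R(X)=X-Z(\tau_r(X)),\quad \widetilde\xi=\dot Z_\mu(\tau_r)\widetilde R^\mu,\quad \widetilde K=\widetilde R/\widetilde\xi,\quad \widetilde\kappa=\ddot Z_\mu(\tau_r)\widetilde K^\mu .$$ For a real vector space $E$ with seminorms $(p_j)_{j\in J}$ let $\mathcal G_E=\mathcal M_E/\mathcal N_E$, where $\mathcal M_E$ (resp. $\mathcal N_E$) consists of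 the nets $(u_\varepsilon)_{0<\varepsilon\le1}$ in $E$ such that for every $j$, $p_j(u_\varepsilon)=O(\varepsilon^{-N})$ as $\varepsilon\to0$ for some $N\in\mathbb N$ (resp. $p_j(u_\varepsilon)=O(\varepsilon^{q})$ for every $q\in\mathbb N$). Let $\mathcal G_\infty(\mathbb R)$ be $\mathcal G_E$ for the real space $E=W^{\infty,\infty}(\mathbb R)$ of smooth functions with all derivatives bounded (seminorms $\|f^{(k)}\|_{L^\infty}$), and $\mathcal G(M)$ be $\mathcal G_E$ for $E=C^\infty(M)$ (real-valued functions, compact uniform convergence of all derivatives). For $E\subseteq\mathcal D'(\Omega)$, $u\in\mathcal G_E$ is associated with $w\in\mathcal D'(\Omega)$, $u\approx w$, if $u_\varepsilon\to w$ in $\mathcal D'(\Omega)$ as $\varepsilon\to0$ for every representative $(u_\varepsilon)$ of $u$. Let $e\in\mathbb R$ and let $H\in\mathcal G_\infty(\mathbb R)$ satisfy $H\approx\theta$, the Heaviside function. For $\alpha\in\{0,1,2,3\}$ put $$\Phi_\alpha=\tfrac e2\,\widetilde R_\alpha\, H(\widetilde\xi),\qquad \Lambda_\alpha=-e\,\frac{\dot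 Z_\alpha(\tau_r)}{\widetilde\xi},\qquad \Psi_\alpha=e\,\widetilde K_\alpha\Big((3\widetilde\xi\widetilde\kappa-2)\,H'(\widetilde\xi)+(\widetilde\xi\widetilde\kappa-\tfrac12)\,\widetilde\xi\,H''(\widetilde\xi)\Big).$$ **Proposition ($\Box\Phi_\alpha\approx\Lambda_\alpha$).** The function $\widetilde\xi$ is smooth on $M$, with $\widetilde\xi>0$ and $\nabla\widetilde\xi\ne0$ everywhere on $M$. The expressions $H(\widetilde\xi)$, $\Phi_\alpha$, $\Lambda_\alpha H(\widetilde\xi)$ and $\Psi_\alpha$, formed on any representative of $H$, define elements of $\mathcal G(M)$ that do not depend on the choice of the representative, and $\Box\Phi_\alpha=\Lambda_\alpha H(\widetilde\xi)+\Psi_\alpha$ in $\mathcal G(M)$. Moreover, in $\mathcal D'(M)$, $$H(\widetilde\xi)\approx1,\qquad \Lambda_\alpha H(\widetilde\xi)\approx\Lambda_\alpha,\qquad \Psi_\alpha\approx0,\qquad\text{and}\qquad \Box\Phi_\alpha\approx\Lambda_\alpha .$$ So, in the sense of association, only the Liénard–Wiechert term survives. -/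

import Mathlib

open Set Filter Topology MeasureTheory TopologicalSpace
open scoped ContDiff Distributions

noncomputable section

/-! ### Colombeau generalized functions based on a locally convex space -/

/-- The filter `ε → 0` on the parameter interval `(0, 1]`. -/
def epsToZero : Filter (Ioc (0 : ℝ) 1) := comap (fun ε => (ε : ℝ)) (𝓝 0)

section Colombeau

variable {E F : Type*} [AddCommGroup E] [Module ℝ E] [AddCommGroup F] [Module ℝ F]
  {J J' : Type*}

/-- The `E`-moderate nets, where the topology of `E` is given by the seminorms `p j`. -/
def moderateNets (p : J → Seminorm ℝ E) : Submodule ℝ (Ioc (0 : ℝ) 1 → E) where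
  carrier := {u | ∀ j, ∃ N : ℕ,
    (fun ε => p j (u ε)) =O[epsToZero] fun ε => (ε : ℝ) ^ (-(N : ℤ))}
  zero_mem' := fun j => ⟨0, Asymptotics.IsBigO.of_bound 1 (Eventually.of_forall fun ε => by simp)⟩
  add_mem' := by
    intro u v hu hv j
    obtain ⟨N, hN⟩ := hu j
    obtain ⟨N', hN'⟩ := hv j
    have key : ∀ {a b : ℕ}, a ≤ b → (fun ε : Ioc (0 : ℝ) 1 => (ε : ℝ) ^ (-(a : ℤ)))
        =O[epsToZero] fun ε => (ε : ℝ) ^ (-(b : ℤ)) := by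
      intro a b hab
      refine Asymptotics.IsBigO.of_bound 1 (Eventually.of_forall fun ε => ?_)
      have h0 : (0 : ℝ) < ε := ε.2.1
      rw [one_mul, Real.norm_of_nonneg (zpow_nonneg h0.le _),
        Real.norm_of_nonneg (zpow_nonneg h0.le _)]
      exact zpow_le_zpow_right_of_le_one₀ h0 ε.2.2 (by omega)
    refine ⟨max N N', ?_⟩
    have h1 := (hN.trans (key (le_max_left N N'))).norm_left.add
      (hN'.trans (key (le_max_right N N'))).norm_left
    refine (Asymptotics.IsBigO.of_bound 1 (Eventually.of_forall fun ε => ?_)).trans h1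
    rw [one_mul, Real.norm_of_nonneg (apply_nonneg _ _), Real.norm_of_nonneg (by positivity)]
    exact (map_add_le_add (p j) _ _).trans (add_le_add (le_abs_self _) (le_abs_self _))
  smul_mem' := by
    intro c u hu j
    obtain ⟨N, hN⟩ := hu j
    refine ⟨N, ?_⟩
    have : (fun ε => p j ((c • u) ε)) = fun ε => ‖c‖ * p j (u ε) := by
      funext ε; simp [map_smul_eq_mul]
    rw [this]
    exact hN.const_mul_left _

/-- The `E`-negligible nets. -/
def negligibleNets (p : J → Seminorm ℝ E) : Submodule ℝ (Ioc (0 : ℝ) 1 → E) where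
  carrier := {u | ∀ j, ∀ q : ℕ, (fun ε => p j (u ε)) =O[epsToZero] fun ε => (ε : ℝ) ^ q}
  zero_mem' := fun j q =>
    Asymptotics.IsBigO.of_bound 1 (Eventually.of_forall fun ε => by simp)
  add_mem' := by
    intro u v hu hv j q
    have h1 := (hu j q).norm_left.add (hv j q).norm_left
    refine (Asymptotics.IsBigO.of_bound 1 (Eventually.of_forall fun ε => ?_)).trans h1
    rw [one_mul, Real.norm_of_nonneg (apply_nonneg _ _), Real.norm_of_nonneg (by positivity)]
    exact (map_add_le_add (p j) _ _).trans (add_le_add (le_abs_self _) (le_abs_self _))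
  smul_mem' := by
    intro c u hu j q
    have : (fun ε => p j ((c • u) ε)) = fun ε => ‖c‖ * p j (u ε) := by
      funext ε; simp [map_smul_eq_mul]
    rw [this]
    exact (hu j q).const_mul_left _

/-- The space `𝒢_E = ℳ_E / 𝒩_E` of generalized functions based on `E`. -/
abbrev GeneralizedFunction (p : J → Seminorm ℝ E) : Type _ :=
  moderateNets p ⧸ (negligibleNets p).submoduleOf (moderateNets p)

/-- The net `u` is a representative of the generalized function `U`. -/
def Represents (p : J → Seminorm ℝ E) (u : Ioc (0 : ℝ) 1 → E) (U : GeneralizedFunction p) :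
    Prop :=
  ∃ hu : u ∈ moderateNets p, Submodule.Quotient.mk ⟨u, hu⟩ = U

/-- The map on generalized functions induced componentwise by a continuous linear map `L`. -/
def generalizedMap (p : J → Seminorm ℝ E) (q : J' → Seminorm ℝ F) (L : E →ₗ[ℝ] F)
    (hL : ∀ j, ∃ i, ∀ f, q j (L f) ≤ p i f) :
    GeneralizedFunction p →ₗ[ℝ] GeneralizedFunction q :=
  have bd : ∀ {j i}, (∀ f, q j (L f) ≤ p i f) → ∀ u : Ioc (0 : ℝ) 1 → E,
      (fun ε => q j (L (u ε))) =O[epsToZero] fun ε => p i (u ε) := fun h u =>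
    Asymptotics.IsBigO.of_bound 1 (Eventually.of_forall fun ε => by
      rw [one_mul, Real.norm_of_nonneg (apply_nonneg _ _),
        Real.norm_of_nonneg (apply_nonneg _ _)]
      exact h _)
  Submodule.mapQ _ _
    ((L.compLeft (Ioc (0 : ℝ) 1)).restrict (p := moderateNets p) (q := moderateNets q)
      (fun u hu j => by
        obtain ⟨i, hi⟩ := hL j
        obtain ⟨N, hN⟩ := hu i
        exact ⟨N, (bd hi u).trans hN⟩))
    (fun u hu j n => by
      obtain ⟨i, hi⟩ := hL j
      exact (bd hi u.1).trans (hu i n))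

/-- For `E ⊆ 𝒟'(Ω)`, with inclusion map `ι`, the generalized function `U` is associated with the
distribution `w`: every representative of `U` converges to `w` in `𝒟'(Ω)` as `ε → 0`, that is,
when tested on every test function. -/
def IsAssociated {V : Type*} [NormedAddCommGroup V] [NormedSpace ℝ V] {Ω : Opens V}
    (p : J → Seminorm ℝ E) (ι : E → 𝓓'(Ω, ℝ)) (U : GeneralizedFunction p) (w : 𝓓'(Ω, ℝ)) :
    Prop :=
  ∀ u, Represents p u U → ∀ φ : 𝓓(Ω, ℝ),
    Tendsto (fun ε => ι (u ε) φ) epsToZero (𝓝 (w φ))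

end Colombeau

/-- The distribution `φ ↦ ∫ φ f` on `Ω` given by a function `f` that is locally integrable
on `Ω`. -/
def regularDistribution {V : Type*} [NormedAddCommGroup V] [NormedSpace ℝ V]
    [MeasureSpace V] [OpensMeasurableSpace V] (Ω : Opens V) (f : V → ℝ) : 𝓓'(Ω, ℝ) :=
  UniformConvergenceCLM.ofFun _ _ _
    (TestFunction.integralAgainstBilinCLM (ContinuousLinearMap.mul ℝ ℝ) volume f)

/-! ### The space `W^{∞,∞}(ℝ)` -/

lemma iteratedDeriv_add_of_smooth {f g : ℝ → ℝ} (hf : ContDiff ℝ ∞ f) (hg : ContDiff ℝ ∞ g)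
    (k : ℕ) (x : ℝ) :
    iteratedDeriv k (f + g) x = iteratedDeriv k f x + iteratedDeriv k g x :=
  iteratedDeriv_add ((hf.of_le (mod_cast le_top)).contDiffAt)
    ((hg.of_le (mod_cast le_top)).contDiffAt)

/-- `W^{∞,∞}(ℝ)`: the smooth functions on `ℝ` all of whose derivatives are bounded. -/
def boundedSmooth : Submodule ℝ (ℝ → ℝ) where
  carrier := {f | ContDiff ℝ ∞ f ∧ ∀ k : ℕ, ∃ C, ∀ x, |iteratedDeriv k f x| ≤ C}
  zero_mem' := ⟨contDiff_const, fun k => ⟨0, fun x => by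
    have : iteratedDeriv k (0 : ℝ → ℝ) x = 0 := by simp
    simp [this]⟩⟩
  add_mem' := by
    rintro f g ⟨hf, hf'⟩ ⟨hg, hg'⟩
    refine ⟨hf.add hg, fun k => ?_⟩
    obtain ⟨C, hC⟩ := hf' k
    obtain ⟨D, hD⟩ := hg' k
    refine ⟨C + D, fun x => ?_⟩
    rw [iteratedDeriv_add_of_smooth hf hg]
    exact (abs_add_le _ _).trans (add_le_add (hC x) (hD x))
  smul_mem' := by
    rintro c f ⟨hf, hf'⟩
    refine ⟨contDiff_const.smul hf, fun k => ?_⟩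
    obtain ⟨C, hC⟩ := hf' k
    refine ⟨|c| * C, fun x => ?_⟩
    rw [iteratedDeriv_const_smul_field, smul_eq_mul, abs_mul]
    exact mul_le_mul_of_nonneg_left (hC x) (abs_nonneg c)

/-- The seminorms `‖f⁽ᵏ⁾‖_{L^∞}`, `k ∈ ℕ`, which define the topology of `W^{∞,∞}(ℝ)`. -/
def boundedSmoothSeminorm (k : ℕ) : Seminorm ℝ boundedSmooth :=
  Seminorm.of (fun f => ⨆ x, |iteratedDeriv k f.1 x|)
    (by
      intro f g
      have bdd : ∀ h : boundedSmooth, BddAbove (range fun x => |iteratedDeriv k h.1 x|) := by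
        intro h
        obtain ⟨C, hC⟩ := h.2.2 k
        exact ⟨C, by rintro _ ⟨x, rfl⟩; exact hC x⟩
      refine ciSup_le fun x => ?_
      have : iteratedDeriv k (f + g).1 x = iteratedDeriv k f.1 x + iteratedDeriv k g.1 x :=
        iteratedDeriv_add_of_smooth f.2.1 g.2.1 k x
      rw [this]
      exact (abs_add_le _ _).trans (add_le_add (le_ciSup (bdd f) x) (le_ciSup (bdd g) x)))
    (by
      intro c f
      have : ∀ x, |iteratedDeriv k (c • f).1 x| = |c| * |iteratedDeriv k f.1 x| := by
        intro x
        have : iteratedDeriv k (c • f).1 x = c • iteratedDeriv k f.1 x :=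
          iteratedDeriv_const_smul_field c f.1
        rw [this, smul_eq_mul, abs_mul]
      simp only [this, Real.norm_eq_abs]
      exact (Real.mul_iSup_of_nonneg (abs_nonneg c) _).symm)

/-- The inclusion `W^{∞,∞}(ℝ) ⊆ 𝒟'(ℝ)`. -/
def boundedSmoothToDistribution (f : boundedSmooth) : 𝓓'((⊤ : Opens ℝ), ℝ) :=
  regularDistribution ⊤ f.1

/-- The Heaviside function. -/
def heaviside : ℝ → ℝ := indicator (Ioi 0) 1

/-! ### The space `C^∞(Ω)` for an open subset `Ω` of spacetime -/

/-- Minkowski space `ℝ⁴`, points and vectors being given by their contravariant components. -/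
abbrev Minkowski : Type := Fin 4 → ℝ

/-- `C^∞(Ω)`. Its elements are given by functions on `ℝ⁴` that are smooth on `Ω`; values outside
of `Ω` play no role, being ignored by all the seminorms below. -/
def smoothOn (Ω : Opens Minkowski) : Submodule ℝ (Minkowski → ℝ) where
  carrier := {f | ContDiffOn ℝ ∞ f Ω}
  zero_mem' := contDiffOn_const
  add_mem' := fun hf hg => ContDiffOn.add hf hg
  smul_mem' := fun _ _ hf => contDiffOn_const.smul hf

lemma smoothOn_differentiableAt {Ω : Opens Minkowski} (f : smoothOn Ω) {X : Minkowski}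
    (hX : X ∈ Ω) : DifferentiableAt ℝ f.1 X :=
  ((f.2 : ContDiffOn ℝ ∞ f.1 Ω).contDiffAt (Ω.isOpen.mem_nhds hX)).differentiableAt (by simp)

/-- The partial derivative `∂/∂X^μ` on `C^∞(Ω)`. -/
def partialDeriv (Ω : Opens Minkowski) (μ : Fin 4) : smoothOn Ω →ₗ[ℝ] smoothOn Ω where
  toFun f := ⟨indicator (Ω : Set Minkowski) fun X => fderiv ℝ f.1 X (Pi.single μ 1), by
    have h : ContDiffOn ℝ ∞ (fun X => fderiv ℝ f.1 X (Pi.single μ 1)) Ω :=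
      ((f.2 : ContDiffOn ℝ ∞ f.1 Ω).fderiv_of_isOpen Ω.isOpen (by simp)).clm_apply
        contDiffOn_const
    exact h.congr fun X hX => indicator_of_mem hX _⟩
  map_add' f g := by
    ext X
    by_cases hX : X ∈ (Ω : Set Minkowski)
    · have := fderiv_add (smoothOn_differentiableAt f hX) (smoothOn_differentiableAt g hX)
      simp [hX, this]
    · simp [hX]
  map_smul' c f := by
    ext X
    by_cases hX : X ∈ (Ω : Set Minkowski)
    · have := fderiv_const_smul (smoothOn_differentiableAt f hX) c
      simp [hX, this]
    · simp [hX]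

/-- The iterated partial derivative `∂_{μ₁} ⋯ ∂_{μₘ}` for a list of indices. -/
def iteratedPartialDeriv (Ω : Opens Minkowski) : List (Fin 4) → (smoothOn Ω →ₗ[ℝ] smoothOn Ω)
  | [] => LinearMap.id
  | μ :: l => iteratedPartialDeriv Ω l ∘ₗ partialDeriv Ω μ

/-- The index set of the seminorms of `C^∞(Ω)`: compact subsets of `Ω` and lists of indices. -/
abbrev SmoothOnIndex (Ω : Opens Minkowski) : Type :=
  {K : Compacts Minkowski // (K : Set Minkowski) ⊆ Ω} × List (Fin 4)

/-- The seminorms `sup_{X ∈ K} |∂_{μ₁} ⋯ ∂_{μₘ} f(X)|` of `C^∞(Ω)`: compact uniform convergence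
of all derivatives. -/
def smoothOnSeminorm (Ω : Opens Minkowski) (j : SmoothOnIndex Ω) : Seminorm ℝ (smoothOn Ω) :=
  Seminorm.of (fun f => ⨆ X : (j.1.1 : Set Minkowski), |(iteratedPartialDeriv Ω j.2 f).1 X|)
    (by
      intro f g
      have bdd : ∀ h : smoothOn Ω, BddAbove
          (range fun X : (j.1.1 : Set Minkowski) => |(iteratedPartialDeriv Ω j.2 h).1 X|) := by
        intro h
        have hc : ContinuousOn (fun X => |(iteratedPartialDeriv Ω j.2 h).1 X|) j.1.1 :=
          ((iteratedPartialDeriv Ω j.2 h).2.continuousOn.mono j.1.2).abs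
        have := j.1.1.isCompact.bddAbove_image hc
        rwa [image_eq_range] at this
      rcases isEmpty_or_nonempty (j.1.1 : Set Minkowski) with he | hne
      · simp [Real.iSup_of_isEmpty]
      refine ciSup_le fun X => ?_
      rw [map_add]
      exact (abs_add_le _ _).trans (add_le_add (le_ciSup (bdd f) X) (le_ciSup (bdd g) X)))
    (by
      intro c f
      have : ∀ X, |(iteratedPartialDeriv Ω j.2 (c • f)).1 X|
          = |c| * |(iteratedPartialDeriv Ω j.2 f).1 X| := by
        intro X
        rw [map_smul, ← abs_mul]
        rfl
      simp only [this, Real.norm_eq_abs]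
      exact (Real.mul_iSup_of_nonneg (abs_nonneg c) _).symm)

/-- The special Colombeau algebra `𝒢(Ω)`, that is, `𝒢_E` for `E = C^∞(Ω)`. -/
abbrev Colombeau (Ω : Opens Minkowski) : Type := GeneralizedFunction (smoothOnSeminorm Ω)

/-- The net of functions `u` consists of elements of `C^∞(Ω)` and represents `U ∈ 𝒢(Ω)`. -/
def RepresentsOn {Ω : Opens Minkowski} (u : Ioc (0 : ℝ) 1 → Minkowski → ℝ) (U : Colombeau Ω) :
    Prop :=
  ∃ hu : ∀ ε, u ε ∈ smoothOn Ω, Represents (smoothOnSeminorm Ω) (fun ε => ⟨u ε, hu ε⟩) U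

/-- `U ≈ f` in `𝒟'(Ω)`, for `U ∈ 𝒢(Ω)` and a function `f` that is locally integrable on `Ω`. -/
def AssociatedOn {Ω : Opens Minkowski} (U : Colombeau Ω) (f : Minkowski → ℝ) : Prop :=
  LocallyIntegrableOn f Ω ∧
    IsAssociated (smoothOnSeminorm Ω) (fun g => regularDistribution Ω g.1) U
      (regularDistribution Ω f)

/-- The partial derivative `∂/∂X^μ` on `𝒢(Ω)`. -/
def colombeauDeriv (Ω : Opens Minkowski) (μ : Fin 4) : Colombeau Ω →ₗ[ℝ] Colombeau Ω :=
  generalizedMap _ _ (partialDeriv Ω μ) fun j => ⟨(j.1, μ :: j.2), fun _ => le_rfl⟩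

/-! ### Minkowski geometry and the retarded quantities of a world line -/

/-- The diagonal entries of the metric of signature `(+,-,-,-)`. -/
def metricSign : Fin 4 → ℝ := ![1, -1, -1, -1]

/-- The Lorentz inner product `x_μ y^μ`. -/
def lorentz (x y : Minkowski) : ℝ := ∑ μ, metricSign μ * x μ * y μ

/-- The covariant component `x_α`. -/
def lower (x : Minkowski) (α : Fin 4) : ℝ := metricSign α * x α

/-- The d'Alembert operator `□ = ∂^μ ∂_μ` on `𝒢(Ω)`. -/
def dAlembert (Ω : Opens Minkowski) : Colombeau Ω →ₗ[ℝ] Colombeau Ω :=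
  ∑ μ, metricSign μ • (colombeauDeriv Ω μ ∘ₗ colombeauDeriv Ω μ)

/-- A smooth world line, parametrized by eigentime and future-directed. -/
structure IsWorldLine (Z : ℝ → Minkowski) : Prop where
  smooth : ContDiff ℝ ∞ Z
  eigentime : ∀ τ, lorentz (deriv Z τ) (deriv Z τ) = 1
  future : ∀ τ, 0 < deriv Z τ 0

/-- `τ` is a retarded proper time for `X`: the vector `X - Z(τ)` is null and future-directed,
i.e. `Z(τ)` lies on the backward light cone emanating from `X`. -/
def IsRetardedTime (Z : ℝ → Minkowski) (X : Minkowski) (τ : ℝ) : Prop :=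
  lorentz (X - Z τ) (X - Z τ) = 0 ∧ 0 < (X - Z τ) 0

lemma lorentz_pos_of_timelike_of_null {u r : Minkowski} (hu : lorentz u u = 1) (hu0 : 0 < u 0)
    (hr : lorentz r r = 0) (hr0 : 0 < r 0) : 0 < lorentz u r := by
  simp only [lorentz, metricSign, Fin.sum_univ_four, Matrix.cons_val] at *
  by_contra! h
  have h1 : u 0 * r 0 ≤ u 1 * r 1 + u 2 * r 2 + u 3 * r 3 := by linarith
  have h2 : (u 0 * r 0) ^ 2 ≤ (u 1 * r 1 + u 2 * r 2 + u 3 * r 3) ^ 2 :=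
    pow_le_pow_left₀ (by positivity) h1 2
  have h3 : (u 1 * r 1 + u 2 * r 2 + u 3 * r 3) ^ 2
      ≤ (u 1 ^ 2 + u 2 ^ 2 + u 3 ^ 2) * (r 1 ^ 2 + r 2 ^ 2 + r 3 ^ 2) := by
    nlinarith [sq_nonneg (u 1 * r 2 - u 2 * r 1), sq_nonneg (u 1 * r 3 - u 3 * r 1),
      sq_nonneg (u 2 * r 3 - u 3 * r 2)]
  have h4 : u 1 ^ 2 + u 2 ^ 2 + u 3 ^ 2 = u 0 ^ 2 - 1 := by linarith
  have h5 : r 1 ^ 2 + r 2 ^ 2 + r 3 ^ 2 = r 0 ^ 2 := by linarith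
  rw [h4, h5] at h3
  nlinarith [pow_pos hr0 2]

lemma IsWorldLine.isOpen_retarded {Z : ℝ → Minkowski} (hZ : IsWorldLine Z) :
    IsOpen {X | ∃ τ, IsRetardedTime Z X τ} := by
  have hZc : Continuous Z := hZ.smooth.continuous
  have hcont : Continuous fun q : Minkowski × ℝ => lorentz (q.1 - Z q.2) (q.1 - Z q.2) := by
    unfold lorentz
    fun_prop
  rw [isOpen_iff_mem_nhds]
  rintro X ⟨τ, hnull, hfut⟩
  have hd : ∀ μ, HasDerivAt (fun s => (X - Z s) μ) (-(deriv Z τ μ)) τ := by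
    intro μ
    have h1 : HasDerivAt Z (deriv Z τ) τ :=
      ((hZ.smooth.differentiable (by simp)) τ).hasDerivAt
    have h2 := (hasDerivAt_pi.1 h1 μ).const_sub (X μ)
    simpa using h2
  have hder : HasDerivAt (fun s => lorentz (X - Z s) (X - Z s))
      (-2 * lorentz (deriv Z τ) (X - Z τ)) τ := by
    unfold lorentz
    have := HasDerivAt.fun_sum (u := Finset.univ) fun μ _ =>
      ((hd μ).const_mul (metricSign μ)).mul (hd μ)
    refine this.congr_deriv ?_
    rw [Finset.mul_sum]
    exact Finset.sum_congr rfl fun μ _ => by ring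
  have hpos := lorentz_pos_of_timelike_of_null (hZ.eigentime τ) (hZ.future τ) hnull hfut
  have hneg : -2 * lorentz (deriv Z τ) (X - Z τ) < 0 := by linarith
  have hslope := hasDerivAt_iff_tendsto_slope.1 hder |>.eventually (gt_mem_nhds hneg)
  have hfutev : ∀ᶠ s in 𝓝 τ, 0 < (X - Z s) 0 := by
    have : Continuous fun s => (X - Z s) 0 := by fun_prop
    exact this.continuousAt.eventually (lt_mem_nhds hfut)
  obtain ⟨δ, hδ, hball⟩ := Metric.eventually_nhds_iff.1
    ((eventually_nhdsWithin_iff.1 hslope).and hfutev)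
  have ha := (hball (y := τ - δ / 2) (by
    rw [Real.dist_eq, abs_lt]; constructor <;> linarith)).1
    (by simp [hδ.ne'])
  have hb := hball (y := τ + δ / 2) (by
    rw [Real.dist_eq, abs_lt]; constructor <;> linarith)
  have hb1 := hb.1 (by simp [hδ.ne'])
  have hb2 := hb.2
  rw [slope_def_field, hnull] at ha hb1
  have ha' : 0 < lorentz (X - Z (τ - δ / 2)) (X - Z (τ - δ / 2)) := by
    by_contra! h
    exact absurd ha (not_lt.2 (div_nonneg_of_nonpos (by linarith) (by linarith)))
  have hb' : lorentz (X - Z (τ + δ / 2)) (X - Z (τ + δ / 2)) < 0 := by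
    by_contra! h
    exact absurd hb1 (not_lt.2 (div_nonneg (by linarith) (by linarith)))
  have e1 : ∀ᶠ Y in 𝓝 X, 0 < lorentz (Y - Z (τ - δ / 2)) (Y - Z (τ - δ / 2)) :=
    (hcont.comp (continuous_id.prodMk continuous_const)).continuousAt.eventually
      (lt_mem_nhds ha')
  have e2 : ∀ᶠ Y in 𝓝 X, lorentz (Y - Z (τ + δ / 2)) (Y - Z (τ + δ / 2)) < 0 :=
    (hcont.comp (continuous_id.prodMk continuous_const)).continuousAt.eventually
      (gt_mem_nhds hb')
  have e3 : ∀ᶠ Y : Minkowski in 𝓝 X, 0 < (Y - Z (τ + δ / 2)) 0 := by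
    have : Continuous fun Y : Minkowski => (Y - Z (τ + δ / 2)) 0 := by fun_prop
    exact this.continuousAt.eventually (lt_mem_nhds hb2)
  filter_upwards [e1, e2, e3] with Y h1 h2 h3
  obtain ⟨s, hs, hs0⟩ := intermediate_value_Icc' (by linarith : τ - δ / 2 ≤ τ + δ / 2)
    (f := fun s => lorentz (Y - Z s) (Y - Z s))
    (hcont.comp (continuous_const.prodMk continuous_id)).continuousOn
    (show (0 : ℝ) ∈ Icc _ _ from ⟨h2.le, h1.le⟩)
  refine ⟨s, hs0, ?_⟩
  have hmono : StrictMono fun s => Z s 0 := by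
    refine strictMono_of_deriv_pos fun s => ?_
    have h1 : HasDerivAt Z (deriv Z s) s :=
      ((hZ.smooth.differentiable (by simp)) s).hasDerivAt
    rw [(hasDerivAt_pi.1 h1 0).deriv]
    exact hZ.future s
  have := hmono.monotone hs.2
  simp only [Pi.sub_apply] at h3 this ⊢
  linarith

/-- The open set of all events `X` for which the retarded proper time exists. -/
def retardedDomain (Z : ℝ → Minkowski) (hZ : IsWorldLine Z) : Opens Minkowski :=
  ⟨{X | ∃ τ, IsRetardedTime Z X τ}, hZ.isOpen_retarded⟩

/-- The retarded proper time `τ_r(X)`. -/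
def retardedTime (Z : ℝ → Minkowski) (X : Minkowski) : ℝ :=
  Classical.epsilon (IsRetardedTime Z X)

/-- `R̃(X) = X - Z(τ_r(X))`. -/
def retR (Z : ℝ → Minkowski) (X : Minkowski) : Minkowski := X - Z (retardedTime Z X)

/-- The four-velocity `Ż(τ_r(X))`. -/
def retVelocity (Z : ℝ → Minkowski) (X : Minkowski) : Minkowski := deriv Z (retardedTime Z X)

/-- The retarded distance `ξ̃ = Ż_μ R̃^μ`. -/
def retXi (Z : ℝ → Minkowski) (X : Minkowski) : ℝ := lorentz (retVelocity Z X) (retR Z X)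

/-- The null vector `K̃ = R̃ / ξ̃`. -/
def retK (Z : ℝ → Minkowski) (X : Minkowski) : Minkowski := (retXi Z X)⁻¹ • retR Z X

/-- The acceleration invariant `κ̃ = Z̈_μ K̃^μ`. -/
def retKappa (Z : ℝ → Minkowski) (X : Minkowski) : ℝ :=
  lorentz (deriv (deriv Z) (retardedTime Z X)) (retK Z X)

/-- The Liénard–Wiechert potential `Λ_α = -e Ż_α / ξ̃`. -/
def lienardWiechert (e : ℝ) (Z : ℝ → Minkowski) (α : Fin 4) (X : Minkowski) : ℝ :=
  -e * lower (retVelocity Z X) α / retXi Z X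

/-- `Φ_α = (e/2) R̃_α · (h ∘ ξ̃)`, for a smooth function `h`. -/
def phiOf (e : ℝ) (Z : ℝ → Minkowski) (h : ℝ → ℝ) (α : Fin 4) (X : Minkowski) : ℝ :=
  e / 2 * lower (retR Z X) α * h (retXi Z X)

/-- `Ψ_α = e K̃_α ((3 ξ̃ κ̃ - 2) (h' ∘ ξ̃) + (ξ̃ κ̃ - 1/2) ξ̃ (h'' ∘ ξ̃))`, for a smooth
function `h`. -/
def psiOf (e : ℝ) (Z : ℝ → Minkowski) (h : ℝ → ℝ) (α : Fin 4) (X : Minkowski) : ℝ :=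
  e * lower (retK Z X) α *
    ((3 * (retXi Z X * retKappa Z X) - 2) * deriv h (retXi Z X) +
      (retXi Z X * retKappa Z X - 1 / 2) * retXi Z X * deriv (deriv h) (retXi Z X))

end

/-! Everything rests on the vector field `K̃`, which is smooth on `M` and satisfies `K̃·∂ξ̃ = 1`
(`fderiv_retXi_retK`), because `∂_μ ξ̃ = (ξ̃κ̃ - 1) K̃_μ + Ż_μ`, `K̃² = 0` and `Ż·K̃ = 1`. Write `T
φ = ∑ ∂_μ(K̃^μ φ)` for `transposeDeriv`. Integration by parts gives `∫ g'(ξ̃) φ = -∫ g(ξ̃) T φ`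
(`integral_comp_mul_transposeDeriv`): derivatives in the variable `ξ̃` can be moved to the test
function, without coordinates adapted to `ξ̃`.

Convergence of `h_ε ∘ ξ̃`: the push-forward of `φ` under `ξ̃` has the density `ρ(t) = ∫ (t - ξ̃)₊
T²φ`, the second derivative in `t` of `∫ (t - ξ̃)₊ φ`. The same integration by parts shows that each
`t`-derivative merely replaces the test function by its image under `T`, so `ρ` is smooth
(`contDiff_rampIntegral`); it is supported in an interval `[a, b]` that contains `ξ̃(supp φ)`. Since
`ξ̃ > 0`, one can take `a > 0`. Then `∫ h_ε(ξ̃) φ = ∫ h_ε ρ`, and this tends to `∫ θ ρ = ∫ ρ = ∫ φ`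
(`tendsto_integral_comp_mul_test`). Hence `H(ξ̃) ≈ 1`, and multiplying `φ` by `Λ_α` gives `Λ_α H(ξ̃)
≈ Λ_α`.

For `Ψ_α`, which involves only `H'` and `H''`, shifting these derivatives to the test function
leaves `∫ h_ε(ξ̃) χ` with `χ` in the image of `T`. The limit is `∫ χ`, the integral of a divergence,
which is zero (`exists_integral_psi_eq`).

The identity for `□Φ_α` holds exactly for each smooth `h`: it is a contraction of second derivatives
using `K̃² = 0`, `Ż·K̃ = Ż² = 1` and `Z̈·K̃ = κ̃` (`sum_metricSign_mul_hessPhi`). Independence of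
the representative follows because all the generalized functions are images of `H` under linear maps
`h ↦ a · h⁽ᵏ⁾(ξ̃)`, or sums of such, whose seminorms are bounded by finitely many seminorms of `h`
(`finsetBounded_compMap`). -/

noncomputable section

/-! ### Test functions and integration by parts along a vector field -/

section TestFunctions

variable {Ω : Opens Minkowski}

lemma smoothOn.continuousOn (a : smoothOn Ω) : ContinuousOn a.1 Ω :=
  ContDiffOn.continuousOn a.2

/-- The product of a smooth function and a test function. -/
def mulTest (a : smoothOn Ω) (φ : 𝓓(Ω, ℝ)) : 𝓓(Ω, ℝ) where
  toFun x := a.1 x * φ x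
  contDiff' := by
    rw [contDiff_iff_contDiffAt]
    intro x
    -- Nothing is known about `a` outside of `Ω`, but off the closed support of `φ` the product
    -- vanishes in a neighbourhood.
    by_cases hx : x ∈ tsupport φ
    · exact (ContDiffOn.contDiffAt a.2 (Ω.isOpen.mem_nhds (φ.tsupport_subset hx))).mul
        φ.contDiff.contDiffAt
    · have h0 : (fun x => a.1 x * φ x) =ᶠ[𝓝 x] fun _ => 0 := by
        filter_upwards [notMem_tsupport_iff_eventuallyEq.1 hx] with y hy
        simp [hy]
      exact contDiffAt_const.congr_of_eventuallyEq h0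
  hasCompactSupport' := φ.hasCompactSupport.mul_left
  tsupport_subset' := (tsupport_mul_subset_right).trans φ.tsupport_subset

@[simp] lemma mulTest_apply (a : smoothOn Ω) (φ : 𝓓(Ω, ℝ)) (x : Minkowski) :
    mulTest a φ x = a.1 x * φ x := rfl

lemma continuous_mul_test {f : Minkowski → ℝ} (hf : ContinuousOn f Ω) (φ : 𝓓(Ω, ℝ)) :
    Continuous fun x => f x * φ x := by
  rw [continuous_iff_continuousAt]
  intro x
  by_cases hx : x ∈ tsupport φ
  · exact (hf.continuousAt (Ω.isOpen.mem_nhds (φ.tsupport_subset hx))).mul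
      φ.continuous.continuousAt
  · have h0 : (fun x => f x * φ x) =ᶠ[𝓝 x] fun _ => 0 := by
      filter_upwards [notMem_tsupport_iff_eventuallyEq.1 hx] with y hy
      simp [hy]
    exact continuousAt_const.congr h0.symm

lemma integrable_mul_test {f : Minkowski → ℝ} (hf : ContinuousOn f Ω) (φ : 𝓓(Ω, ℝ)) :
    Integrable fun x => f x * φ x :=
  (continuous_mul_test hf φ).integrable_of_hasCompactSupport φ.hasCompactSupport.mul_left

/-- The transpose `φ ↦ ∑ ∂_μ (K^μ φ)` of the derivation `-K^μ ∂_μ`, acting on test functions. -/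
def transposeDeriv (K : Fin 4 → smoothOn Ω) (φ : 𝓓(Ω, ℝ)) : 𝓓(Ω, ℝ) :=
  ∑ μ, LineDeriv.lineDerivOp (Pi.single μ (1 : ℝ) : Minkowski) (mulTest (K μ) φ)

lemma transposeDeriv_apply (K : Fin 4 → smoothOn Ω) (φ : 𝓓(Ω, ℝ)) (x : Minkowski) :
    transposeDeriv K φ x =
      ∑ μ, fderiv ℝ (mulTest (K μ) φ) x (Pi.single μ 1) := by
  have (μ : Fin 4) : LineDeriv.lineDerivOp (Pi.single μ (1 : ℝ) : Minkowski) (mulTest (K μ) φ) x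
      = fderiv ℝ (mulTest (K μ) φ) x (Pi.single μ 1) := by
    rw [TestFunction.lineDerivOp_eq_lineDerivCLM (𝕜 := ℝ),
        TestFunction.lineDerivCLM_apply_of_le (by simp)]
    exact ((mulTest (K μ) φ).contDiff.differentiable (by simp) x).lineDeriv_eq_fderiv
  simp [transposeDeriv, ← this]

/-- A differential operator is local; this keeps the range of `ξ` on the support under control when
the operator is iterated. -/
lemma tsupport_transposeDeriv_subset (K : Fin 4 → smoothOn Ω) (φ : 𝓓(Ω, ℝ)) :
    tsupport (transposeDeriv K φ) ⊆ tsupport φ := by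
  refine closure_minimal (fun x hx => ?_) (isClosed_tsupport _)
  by_contra h
  refine hx ?_
  rw [transposeDeriv_apply]
  refine Finset.sum_eq_zero fun μ _ => ?_
  have h0 : (mulTest (K μ) φ : Minkowski → ℝ) =ᶠ[𝓝 x] fun _ => 0 := by
    filter_upwards [notMem_tsupport_iff_eventuallyEq.1 h] with y hy
    simp [hy]
  rw [h0.fderiv_eq]
  simp

/-- Integration by parts for the derivation `K^μ ∂_μ`. -/
lemma integral_fderiv_mul_test (K : Fin 4 → smoothOn Ω) {f : Minkowski → ℝ}
    (hf : ContDiffOn ℝ 1 f Ω) (φ : 𝓓(Ω, ℝ)) :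
    ∫ x, fderiv ℝ f x (fun μ => (K μ).1 x) * φ x = -∫ x, f x * transposeDeriv K φ x := by
  have hf' : ContinuousOn (fderiv ℝ f) Ω := hf.continuousOn_fderiv_of_isOpen Ω.isOpen le_rfl
  have hfv (μ : Fin 4) : ContinuousOn (fun x => fderiv ℝ f x (Pi.single μ 1)) Ω :=
    hf'.clm_apply continuousOn_const
  have hfc := hf.continuousOn
  have hd : ∀ x ∈ Ω, DifferentiableAt ℝ f x := fun x hx =>
    (hf.contDiffAt (Ω.isOpen.mem_nhds hx)).differentiableAt (by simp)
  have key (μ : Fin 4) : Integrable (fun x => f x *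
      fderiv ℝ (mulTest (K μ) φ) x (Pi.single μ 1)) ∧
      ∫ x, f x * fderiv ℝ (mulTest (K μ) φ) x (Pi.single μ 1) =
        -∫ x, fderiv ℝ f x (Pi.single μ 1) * mulTest (K μ) φ x := by
    have hi : Integrable (fun x => f x *
        fderiv ℝ (mulTest (K μ) φ) x (Pi.single μ 1)) := by
      have := integrable_mul_test hfc
        (LineDeriv.lineDerivOp (Pi.single μ (1 : ℝ) : Minkowski) (mulTest (K μ) φ))
      refine this.congr (Eventually.of_forall fun x => ?_)
      simp only
      rw [TestFunction.lineDerivOp_eq_lineDerivCLM (𝕜 := ℝ),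
        TestFunction.lineDerivCLM_apply_of_le (by simp),
        ((mulTest (K μ) φ).contDiff.differentiable (by simp) x).lineDeriv_eq_fderiv]
    refine ⟨hi, integral_mul_fderiv_eq_neg_fderiv_mul_of_integrable
      (integrable_mul_test (hfv μ) _) hi (integrable_mul_test hfc _)
      (fun x hx => hd x ((mulTest (K μ) φ).tsupport_subset hx))
      (fun x _ => (mulTest (K μ) φ).contDiff.differentiable (by simp) x)⟩
  have e1 (x : Minkowski) : f x * transposeDeriv K φ x =
      ∑ μ, f x * fderiv ℝ (mulTest (K μ) φ) x (Pi.single μ 1) := by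
    rw [transposeDeriv_apply, Finset.mul_sum]
  have e2 (x : Minkowski) : fderiv ℝ f x (fun μ => (K μ).1 x) * φ x =
      ∑ μ, fderiv ℝ f x (Pi.single μ 1) * mulTest (K μ) φ x := by
    have : (fun μ => (K μ).1 x) = ∑ μ, (K μ).1 x • (Pi.single μ (1 : ℝ) : Minkowski) := by
      simpa using (pi_eq_sum_univ' (fun μ => (K μ).1 x) : _)
    rw [this, map_sum, Finset.sum_mul]
    refine Finset.sum_congr rfl fun μ _ => ?_
    simp only [map_smul, smul_eq_mul, mulTest_apply]
    ring
  simp_rw [e1, e2]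
  rw [integral_finsetSum _ fun μ _ => (key μ).1,
    integral_finsetSum _ fun μ _ => integrable_mul_test (hfv μ) _, ← Finset.sum_neg_distrib]
  exact Finset.sum_congr rfl fun μ _ => by rw [(key μ).2, neg_neg]

end TestFunctions

/-! ### The density of the push-forward of a test function -/

section Pushforward

variable {Ω : Opens Minkowski} {ξ : Minkowski → ℝ} {K : Fin 4 → smoothOn Ω}

/-- If the derivation `K^μ ∂_μ` maps `ξ` to `1`, then it maps `g ∘ ξ` to `g' ∘ ξ`. -/
lemma integral_comp_mul_transposeDeriv (hξ : ContDiffOn ℝ ∞ ξ Ω)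
    (hK : ∀ x ∈ Ω, fderiv ℝ ξ x (fun μ => (K μ).1 x) = 1) {g g' : ℝ → ℝ}
    (hg : ∀ s, HasDerivAt g (g' s) s) (hg' : Continuous g') (φ : 𝓓(Ω, ℝ)) :
    ∫ x, g' (ξ x) * φ x = -∫ x, g (ξ x) * transposeDeriv K φ x := by
  have hgc : ContDiff ℝ 1 g := by
    rw [contDiff_one_iff_deriv, show deriv g = g' from funext fun s => (hg s).deriv]
    exact ⟨fun s => (hg s).differentiableAt, hg'⟩
  rw [← integral_fderiv_mul_test K (f := fun x => g (ξ x))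
    (hgc.comp_contDiffOn (hξ.of_le (mod_cast le_top)))]
  refine integral_congr_ae (Eventually.of_forall fun x => ?_)
  by_cases hx : x ∈ Ω
  · have hd : HasFDerivAt ξ (fderiv ℝ ξ x) x :=
      ((hξ.contDiffAt (Ω.isOpen.mem_nhds hx)).differentiableAt (by simp)).hasFDerivAt
    have := ((hg (ξ x)).comp_hasFDerivAt x hd).fderiv
    simp only [Function.comp_def] at this
    simp [this, hK x hx]
  · have : φ x = 0 := image_eq_zero_of_notMem_tsupport fun h => hx (φ.tsupport_subset h)
    simp [this]

/-- This is the integral of a compactly supported divergence, obtained here by inserting a constant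
`g`. -/
lemma integral_transposeDeriv (hξ : ContDiffOn ℝ ∞ ξ Ω)
    (hK : ∀ x ∈ Ω, fderiv ℝ ξ x (fun μ => (K μ).1 x) = 1) (φ : 𝓓(Ω, ℝ)) :
    ∫ x, transposeDeriv K φ x = 0 := by
  have := integral_comp_mul_transposeDeriv hξ hK (g := fun _ => 1) (g' := fun _ => 0)
    (fun s => hasDerivAt_const s 1) continuous_const φ
  simpa using this

/-- The integral `∫ (t - ξ)₊ φ` as a function of `t`. -/
def rampIntegral (ξ : Minkowski → ℝ) (φ : 𝓓(Ω, ℝ)) (t : ℝ) : ℝ := ∫ x, max (t - ξ x) 0 * φ x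

/-- Squaring removes the kink of the ramp: at the origin the function is `O(u²)`. The ramp thus has
a `C¹` antiderivative, to which the integration by parts applies. -/
lemma hasDerivAt_max_sq (u : ℝ) : HasDerivAt (fun u : ℝ => max u 0 ^ 2 / 2) (max u 0) u := by
  rcases lt_trichotomy u 0 with h | rfl | h
  · rw [max_eq_right h.le]
    refine (hasDerivAt_const u (0 : ℝ)).congr_of_eventuallyEq ?_
    filter_upwards [gt_mem_nhds h] with v hv
    simp [max_eq_right hv.le]
  · rw [hasDerivAt_iff_isLittleO_nhds_zero]
    simp only [zero_add, max_self]
    refine Asymptotics.IsBigO.trans_isLittleO (g := fun h : ℝ => h ^ 2) ?_ ?_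
    · refine Asymptotics.IsBigO.of_bound 1 (Eventually.of_forall fun v => ?_)
      rcases le_total v 0 with hv | hv
      · simp [max_eq_right hv, sq_nonneg]
      · simp only [max_eq_left hv]
        rw [Real.norm_eq_abs, Real.norm_eq_abs, abs_of_nonneg (by simp; positivity),
          abs_of_nonneg (by positivity)]
        simp
        nlinarith [sq_nonneg v]
    · exact Asymptotics.isLittleO_pow_id one_lt_two
  · rw [max_eq_left h.le]
    have : HasDerivAt (fun v : ℝ => v ^ 2 / 2) u u := by
      simpa using (hasDerivAt_pow 2 u).div_const 2
    refine this.congr_of_eventuallyEq ?_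
    filter_upwards [lt_mem_nhds h] with v hv
    simp [max_eq_left hv.le]

/-- Trading `φ` for its image under `transposeDeriv` gains one order of regularity of the kernel,
which makes differentiation in `t` under the integral possible. -/
lemma rampIntegral_eq (hξ : ContDiffOn ℝ ∞ ξ Ω)
    (hK : ∀ x ∈ Ω, fderiv ℝ ξ x (fun μ => (K μ).1 x) = 1) (φ : 𝓓(Ω, ℝ)) (t : ℝ) :
    rampIntegral ξ φ t = ∫ x, max (t - ξ x) 0 ^ 2 / 2 * transposeDeriv K φ x := by
  have := integral_comp_mul_transposeDeriv hξ hK (g := fun s => max (t - s) 0 ^ 2 / 2)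
    (g' := fun s => -max (t - s) 0)
    (fun s => by
      have := (hasDerivAt_max_sq (t - s)).comp s ((hasDerivAt_id s).const_sub t)
      simpa [Function.comp_def] using this) (by fun_prop) φ
  simp only [neg_mul, integral_neg, neg_inj] at this
  exact this

/-- The derivative has the same form, with another test function, so the statement iterates and
yields smoothness. -/
lemma hasDerivAt_rampIntegral (hξ : ContDiffOn ℝ ∞ ξ Ω)
    (hK : ∀ x ∈ Ω, fderiv ℝ ξ x (fun μ => (K μ).1 x) = 1) (φ : 𝓓(Ω, ℝ)) (t : ℝ) :
    HasDerivAt (rampIntegral ξ φ) (rampIntegral ξ (transposeDeriv K φ) t) t := by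
  rw [show rampIntegral ξ φ = _ from funext (rampIntegral_eq hξ hK φ)]
  have hc := hξ.continuousOn
  generalize transposeDeriv K φ = ψ
  have h1 (s : ℝ) : Integrable fun x => max (s - ξ x) 0 * ψ x :=
    integrable_mul_test (f := fun x => max (s - ξ x) 0) (by fun_prop) ψ
  have h2 (s : ℝ) : Integrable fun x => max (s - ξ x) 0 ^ 2 / 2 * ψ x :=
    integrable_mul_test (f := fun x => max (s - ξ x) 0 ^ 2 / 2) (by fun_prop) ψ
  -- Dominating function for `s` in the unit ball around `t`, where `|s| ≤ |t| + 1`.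
  have h3 : Integrable fun x => (|t| + 1 + |ξ x|) * ψ x :=
    integrable_mul_test (f := fun x => |t| + 1 + |ξ x|) (by fun_prop) ψ
  refine (hasDerivAt_integral_of_dominated_loc_of_deriv_le (Metric.ball_mem_nhds t one_pos)
    (Eventually.of_forall fun s => (h2 s).aestronglyMeasurable) (h2 t)
    (F' := fun s x => max (s - ξ x) 0 * ψ x)
    (h1 t).aestronglyMeasurable (bound := fun x => ‖(|t| + 1 + |ξ x|) * ψ x‖)
    (Eventually.of_forall fun x s hs => ?_) h3.norm
    (Eventually.of_forall fun x s _ => ?_)).2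
  · rw [norm_mul, norm_mul]
    refine mul_le_mul_of_nonneg_right ?_ (norm_nonneg _)
    rw [Real.norm_of_nonneg (le_max_right _ _), Real.norm_of_nonneg (by positivity)]
    rw [Metric.mem_ball, Real.dist_eq] at hs
    refine max_le ?_ (by positivity)
    have := abs_lt.1 hs
    linarith [le_abs_self t, neg_abs_le (ξ x)]
  · have := ((hasDerivAt_max_sq (s - ξ x)).comp s ((hasDerivAt_id s).sub_const (ξ x))).mul_const
      (ψ x)
    simpa [Function.comp_def] using this

lemma contDiff_rampIntegral (hξ : ContDiffOn ℝ ∞ ξ Ω)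
    (hK : ∀ x ∈ Ω, fderiv ℝ ξ x (fun μ => (K μ).1 x) = 1) (φ : 𝓓(Ω, ℝ)) :
    ContDiff ℝ ∞ (rampIntegral ξ φ) := by
  rw [contDiff_infty]
  intro n
  induction n generalizing φ with
  | zero =>
    exact contDiff_zero.2 (continuous_iff_continuousAt.2 fun t =>
      (hasDerivAt_rampIntegral hξ hK φ t).continuousAt)
  | succ n ih =>
    rw [Nat.cast_add, Nat.cast_one, contDiff_succ_iff_deriv]
    refine ⟨fun t => (hasDerivAt_rampIntegral hξ hK φ t).differentiableAt, by simp, ?_⟩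
    rw [show deriv (rampIntegral ξ φ) = _ from
      funext fun t => (hasDerivAt_rampIntegral hξ hK φ t).deriv]
    exact ih _

/-- Outside of the range of `ξ` on the support of `φ`, the density of the push-forward of `φ`
vanishes. -/
lemma rampIntegral_eq_zero (hξ : ContDiffOn ℝ ∞ ξ Ω)
    (hK : ∀ x ∈ Ω, fderiv ℝ ξ x (fun μ => (K μ).1 x) = 1) (φ : 𝓓(Ω, ℝ)) {a b : ℝ}
    (hab : ∀ x ∈ tsupport φ, ξ x ∈ Icc a b) {t : ℝ} (ht : t ∉ Icc a b) :
    rampIntegral ξ (transposeDeriv K (transposeDeriv K φ)) t = 0 := by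
  have hs : ∀ x, x ∉ tsupport φ → transposeDeriv K (transposeDeriv K φ) x = 0 := fun x hx =>
    image_eq_zero_of_notMem_tsupport fun h =>
      hx (tsupport_transposeDeriv_subset _ _ (tsupport_transposeDeriv_subset _ _ h))
  rw [mem_Icc, not_and_or, not_le, not_le] at ht
  unfold rampIntegral
  rcases ht with ht | ht
  · refine integral_eq_zero_of_ae (Eventually.of_forall fun x => ?_)
    simp only [Pi.zero_apply]
    by_cases hx : x ∈ tsupport φ
    · rw [max_eq_right (by linarith [(hab x hx).1]), zero_mul]
    · rw [hs x hx, mul_zero]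
  -- For `t > b` the ramp is affine in `ξ` on the support, and two applications of the transpose
  -- annihilate affine functions of `ξ`.
  · have h1 := integral_comp_mul_transposeDeriv hξ hK (g := fun s => t - s) (g' := fun _ => -1)
      (fun s => by simpa using (hasDerivAt_id s).const_sub t) continuous_const
      (transposeDeriv K φ)
    simp only [neg_mul, one_mul, integral_neg, integral_transposeDeriv hξ hK, neg_zero] at h1
    refine Eq.trans (integral_congr_ae (Eventually.of_forall fun x => ?_)) (neg_eq_zero.1 h1.symm)
    by_cases hx : x ∈ tsupport φ
    · simp only
      rw [max_eq_left (by linarith [(hab x hx).2])]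
    · simp only
      rw [hs x hx, mul_zero, mul_zero]

/-- The push-forward of `φ` under `ξ` has a smooth density. -/
lemma integral_comp_mul_test (hξ : ContDiffOn ℝ ∞ ξ Ω)
    (hK : ∀ x ∈ Ω, fderiv ℝ ξ x (fun μ => (K μ).1 x) = 1) (φ : 𝓓(Ω, ℝ)) {a b : ℝ}
    (hle : a ≤ b) (hab : ∀ x ∈ tsupport φ, ξ x ∈ Icc a b) {h : ℝ → ℝ} (hh : Continuous h) :
    ∫ x, h (ξ x) * φ x =
      ∫ t in a..b, h t * rampIntegral ξ (transposeDeriv K (transposeDeriv K φ)) t := by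
  have hth : Continuous fun t => t * h t := by fun_prop
  have d0 (s : ℝ) : HasDerivAt (fun s => ∫ t in s..b, h t) (-h s) s :=
    intervalIntegral.integral_hasDerivAt_left (hh.intervalIntegrable _ _)
      hh.stronglyMeasurable.stronglyMeasurableAtFilter hh.continuousAt
  have d1 (s : ℝ) : HasDerivAt (fun s => ∫ t in s..b, t * h t) (-(s * h s)) s :=
    intervalIntegral.integral_hasDerivAt_left (hth.intervalIntegrable _ _)
      hth.stronglyMeasurable.stronglyMeasurableAtFilter hth.continuousAt
  -- The function `G(s) = ∫_s^b (t - s) h(t) dt` is a second antiderivative of `h`. For `a ≤ s ≤ b`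
  -- it equals `∫_a^b h(t) (t - s)₊ dt`, so two integrations by parts followed by Fubini produce the
  -- density.
  have d2 (s : ℝ) : HasDerivAt (fun s => (∫ t in s..b, t * h t) - s * ∫ t in s..b, h t)
      (-∫ t in s..b, h t) s := by
    refine ((d1 s).sub ((hasDerivAt_id s).mul (d0 s))).congr_deriv ?_
    simp
  have c0 : Continuous fun s => ∫ t in s..b, h t :=
    continuous_iff_continuousAt.2 fun s => (d0 s).continuousAt
  have e1 := integral_comp_mul_transposeDeriv hξ hK d0 (by fun_prop) φ
  have e2 := integral_comp_mul_transposeDeriv hξ hK d2 c0.neg (transposeDeriv K φ)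
  simp only [neg_mul, integral_neg, neg_inj] at e1 e2
  rw [e1, e2]
  set ψ := transposeDeriv K (transposeDeriv K φ) with hψ
  have hsub : tsupport ψ ⊆ tsupport φ :=
    (tsupport_transposeDeriv_subset _ _).trans (tsupport_transposeDeriv_subset _ _)
  have hcont : Continuous fun q : ℝ × Minkowski => h q.1 * (max (q.1 - ξ q.2) 0 * ψ q.2) := by
    rw [continuous_iff_continuousAt]
    rintro ⟨t, x⟩
    by_cases hx : x ∈ tsupport ψ
    · have hc : ContinuousAt ξ x :=
        hξ.continuousOn.continuousAt (Ω.isOpen.mem_nhds (ψ.tsupport_subset hx))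
      have hc' : ContinuousAt (fun q : ℝ × Minkowski => ξ q.2) (t, x) :=
        ContinuousAt.comp (f := Prod.snd) hc continuousAt_snd
      have := ψ.continuous
      fun_prop
    · have h0 : (fun q : ℝ × Minkowski => h q.1 * (max (q.1 - ξ q.2) 0 * ψ q.2))
          =ᶠ[𝓝 (t, x)] fun _ => 0 := by
        have := (continuousAt_snd (p := ((t, x) : ℝ × Minkowski))).eventually
          (notMem_tsupport_iff_eventuallyEq.1 hx)
        filter_upwards [this] with y hy
        simp [show ψ y.2 = 0 from hy]
      exact continuousAt_const.congr h0.symm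
  -- Fubini is justified by continuity on the compact set `[a, b] × supp ψ`, off which the integrand
  -- vanishes for `t` in `[a, b]`.
  have hint : Integrable (Function.uncurry fun t x => h t * (max (t - ξ x) 0 * ψ x))
      ((volume.restrict (uIoc a b)).prod volume) := by
    have h1 : IntegrableOn (fun q : ℝ × Minkowski => h q.1 * (max (q.1 - ξ q.2) 0 * ψ q.2))
        (Icc a b ×ˢ tsupport ψ) ((volume : Measure ℝ).prod volume) :=
      hcont.continuousOn.integrableOn_compact (isCompact_Icc.prod ψ.hasCompactSupport)
    have h2 : IntegrableOn (fun q : ℝ × Minkowski => h q.1 * (max (q.1 - ξ q.2) 0 * ψ q.2))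
        (Icc a b ×ˢ univ) ((volume : Measure ℝ).prod volume) := by
      refine h1.of_forall_sdiff_eq_zero (measurableSet_Icc.prod MeasurableSet.univ) ?_
      rintro ⟨t, x⟩ ⟨⟨h1, -⟩, h2⟩
      have : x ∉ tsupport ψ := fun h => h2 ⟨h1, h⟩
      simp [image_eq_zero_of_notMem_tsupport this]
    rw [IntegrableOn, ← Measure.prod_restrict, Measure.restrict_univ] at h2
    rw [uIoc_of_le hle]
    exact h2.mono_measure
      (Measure.prod_mono (Measure.restrict_mono Ioc_subset_Icc_self le_rfl) le_rfl)
  have e3 (t : ℝ) : h t * rampIntegral ξ ψ t = ∫ x, h t * (max (t - ξ x) 0 * ψ x) := by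
    rw [rampIntegral, integral_const_mul]
  simp_rw [e3]
  rw [intervalIntegral_integral_swap hint]
  refine integral_congr_ae (Eventually.of_forall fun x => ?_)
  simp only
  by_cases hx : x ∈ tsupport ψ
  · have hx' := hab x (hsub hx)
    have hl : ∫ t in a..ξ x, h t * (max (t - ξ x) 0 * ψ x) = 0 := by
      refine intervalIntegral.integral_zero_ae (Eventually.of_forall fun t ht => ?_)
      rw [uIoc_of_le hx'.1] at ht
      rw [max_eq_right (by linarith [ht.2])]
      simp
    have hr : ∫ t in ξ x..b, h t * (max (t - ξ x) 0 * ψ x) =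
        ∫ t in ξ x..b, (t * h t - ξ x * h t) * ψ x := by
      refine intervalIntegral.integral_congr fun t ht => ?_
      rw [uIcc_of_le hx'.2] at ht
      rw [max_eq_left (by linarith [ht.1])]
      ring
    have hcx : Continuous fun t => h t * (max (t - ξ x) 0 * ψ x) := by fun_prop
    have hch : Continuous fun t => ξ x * h t := by fun_prop
    rw [← intervalIntegral.integral_add_adjacent_intervals (hcx.intervalIntegrable a (ξ x))
      (hcx.intervalIntegrable (ξ x) b), hl, hr, zero_add, intervalIntegral.integral_mul_const,
      intervalIntegral.integral_sub (hth.intervalIntegrable _ _)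
        (hch.intervalIntegrable _ _), intervalIntegral.integral_const_mul]
  · simp [image_eq_zero_of_notMem_tsupport hx]

lemma regularDistribution_apply {V : Type*} [NormedAddCommGroup V] [NormedSpace ℝ V]
    [MeasureSpace V] [OpensMeasurableSpace V] {Ω : Opens V} {f : V → ℝ}
    (hf : LocallyIntegrableOn f Ω) (φ : 𝓓(Ω, ℝ)) :
    regularDistribution Ω f φ = ∫ x, f x * φ x := by
  have : regularDistribution Ω f φ = ∫ x, φ x * f x :=
    TestFunction.integralAgainstBilinCLM_eq_integral hf
  simp_rw [this, mul_comm]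

lemma locallyIntegrableOn_heaviside : LocallyIntegrableOn heaviside ((⊤ : Opens ℝ) : Set ℝ) := by
  refine LocallyIntegrable.locallyIntegrableOn ?_ _
  exact (locallyIntegrable_const (1 : ℝ)).indicator measurableSet_Ioi

/-- If `h_ε → θ` in `𝒟'(ℝ)` and `ξ > 0`, then `h_ε ∘ ξ → 1` in `𝒟'(Ω)`. -/
lemma tendsto_integral_comp_mul_test (hξ : ContDiffOn ℝ ∞ ξ Ω)
    (hK : ∀ x ∈ Ω, fderiv ℝ ξ x (fun μ => (K μ).1 x) = 1) (hpos : ∀ x ∈ Ω, 0 < ξ x)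
    {h : Ioc (0 : ℝ) 1 → boundedSmooth}
    (hh : ∀ φ : 𝓓((⊤ : Opens ℝ), ℝ), Tendsto (fun ε => boundedSmoothToDistribution (h ε) φ)
      epsToZero (𝓝 (regularDistribution ⊤ heaviside φ))) (φ : 𝓓(Ω, ℝ)) :
    Tendsto (fun ε => ∫ x, (h ε).1 (ξ x) * φ x) epsToZero (𝓝 (∫ x, φ x)) := by
  obtain ⟨a, b, ha, hle, hab⟩ : ∃ a b, 0 < a ∧ a ≤ b ∧ ∀ x ∈ tsupport φ, ξ x ∈ Icc a b := by
    have hc : ContinuousOn ξ (tsupport φ) := hξ.continuousOn.mono φ.tsupport_subset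
    have hcpt : IsCompact (tsupport φ) := φ.hasCompactSupport
    rcases (tsupport φ).eq_empty_or_nonempty with he | hne
    -- For an empty support any positive interval will do.
    · exact ⟨1, 1, one_pos, le_rfl, by simp [he]⟩
    · obtain ⟨x, hx, hmin⟩ := hcpt.exists_isMinOn hne hc
      obtain ⟨y, hy, hmax⟩ := hcpt.exists_isMaxOn hne hc
      exact ⟨ξ x, ξ y, hpos x (φ.tsupport_subset hx), hmax hx, fun z hz => ⟨hmin hz, hmax hz⟩⟩
  have hout : ∀ t, t ∉ Icc a b → rampIntegral ξ (transposeDeriv K (transposeDeriv K φ)) t = 0 :=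
    fun t ht => rampIntegral_eq_zero hξ hK φ hab ht
  -- The density is itself a test function on the line, so the assumed convergence to the Heaviside
  -- function can be tested on it.
  let P : 𝓓((⊤ : Opens ℝ), ℝ) :=
    { toFun := rampIntegral ξ (transposeDeriv K (transposeDeriv K φ))
      contDiff' := contDiff_rampIntegral hξ hK _
      hasCompactSupport' := HasCompactSupport.intro isCompact_Icc hout
      tsupport_subset' := fun _ _ => trivial }
  have hP (t : ℝ) : P t = rampIntegral ξ (transposeDeriv K (transposeDeriv K φ)) t := rfl
  have key (g : ℝ → ℝ) : ∫ t, g t * P t = ∫ t in a..b, g t * P t := by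
    rw [intervalIntegral.integral_of_le hle, ← integral_Icc_eq_integral_Ioc,
      setIntegral_eq_integral_of_forall_compl_eq_zero]
    intro t ht
    rw [hP, hout t ht, mul_zero]
  have e0 : regularDistribution ⊤ heaviside P = ∫ x, φ x := by
    rw [regularDistribution_apply locallyIntegrableOn_heaviside, key]
    have h1 := integral_comp_mul_test hξ hK φ hle hab (h := fun _ => 1) continuous_const
    simp only [one_mul] at h1
    rw [h1]
    refine intervalIntegral.integral_congr fun t ht => ?_
    rw [uIcc_of_le hle] at ht
    -- Positivity of `ξ` enters here: the interval lies to the right of the jump.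
    have : heaviside t = 1 := indicator_of_mem (show t ∈ Ioi 0 from ha.trans_le ht.1) _
    simp only [this, one_mul, hP]
  have e1 (ε : Ioc (0 : ℝ) 1) :
      boundedSmoothToDistribution (h ε) P = ∫ x, (h ε).1 (ξ x) * φ x := by
    have hc : Continuous (h ε).1 := (h ε).2.1.continuous
    rw [boundedSmoothToDistribution, regularDistribution_apply
      (hc.locallyIntegrable.locallyIntegrableOn _), key, integral_comp_mul_test hξ hK φ hle hab hc]
    rfl
  have := hh P
  simp_rw [e1, e0] at this
  exact this

end Pushforward

/-! ### Linear maps acting on generalized functions -/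

section Nets

variable {E F : Type*} [AddCommGroup E] [Module ℝ E] [AddCommGroup F] [Module ℝ F]
  {J J' : Type*}

lemma tendsto_coe_epsToZero : Tendsto (fun ε : Ioc (0 : ℝ) 1 => (ε : ℝ)) epsToZero (𝓝 0) :=
  tendsto_comap

/-- A linear map each of whose seminorms is bounded by a finite sum of seminorms. -/
def FinsetBounded (p : J → Seminorm ℝ E) (q : J' → Seminorm ℝ F) (L : E →ₗ[ℝ] F) : Prop :=
  ∀ j, ∃ C : ℝ, ∃ s : Finset J, ∀ f, q j (L f) ≤ C * ∑ i ∈ s, p i f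

variable {p : J → Seminorm ℝ E} {q : J' → Seminorm ℝ F} {L L' : E →ₗ[ℝ] F}

lemma exists_bound_of_le_add {r r₁ r₂ : E → ℝ} (hr : ∀ f, r f ≤ r₁ f + r₂ f)
    (h₁ : ∃ C : ℝ, ∃ s : Finset J, ∀ f, r₁ f ≤ C * ∑ i ∈ s, p i f)
    (h₂ : ∃ C : ℝ, ∃ s : Finset J, ∀ f, r₂ f ≤ C * ∑ i ∈ s, p i f) :
    ∃ C : ℝ, ∃ s : Finset J, ∀ f, r f ≤ C * ∑ i ∈ s, p i f := by
  classical
  obtain ⟨C, s, h⟩ := h₁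
  obtain ⟨C', s', h'⟩ := h₂
  -- The constants may be negative, and enlarging the index sets is monotone only for nonnegative
  -- ones.
  refine ⟨|C| + |C'|, s ∪ s', fun f => ?_⟩
  have h0 : ∀ t : Finset J, 0 ≤ ∑ i ∈ t, p i f := fun t =>
    Finset.sum_nonneg fun i _ => apply_nonneg _ _
  have h1 : ∑ i ∈ s, p i f ≤ ∑ i ∈ s ∪ s', p i f :=
    Finset.sum_le_sum_of_subset_of_nonneg Finset.subset_union_left fun _ _ _ => apply_nonneg _ _
  have h2 : ∑ i ∈ s', p i f ≤ ∑ i ∈ s ∪ s', p i f :=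
    Finset.sum_le_sum_of_subset_of_nonneg Finset.subset_union_right fun _ _ _ => apply_nonneg _ _
  calc r f ≤ C * ∑ i ∈ s, p i f + C' * ∑ i ∈ s', p i f := (hr f).trans (add_le_add (h f) (h' f))
    _ ≤ |C| * ∑ i ∈ s ∪ s', p i f + |C'| * ∑ i ∈ s ∪ s', p i f :=
        add_le_add
          (mul_le_mul (le_abs_self _) h1 (h0 _) (abs_nonneg _))
          (mul_le_mul (le_abs_self _) h2 (h0 _) (abs_nonneg _))
    _ = _ := by ring

lemma FinsetBounded.add (hL : FinsetBounded p q L) (hL' : FinsetBounded p q L') :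
    FinsetBounded p q (L + L') := fun j =>
  exists_bound_of_le_add (fun _ => map_add_le_add _ _ _) (hL j) (hL' j)

lemma FinsetBounded.isBigO (hL : FinsetBounded p q L) {u : Ioc (0 : ℝ) 1 → E} (j : J') :
    ∃ s : Finset J, (fun ε => q j (L (u ε))) =O[epsToZero] fun ε => ∑ i ∈ s, p i (u ε) := by
  obtain ⟨C, s, h⟩ := hL j
  refine ⟨s, Asymptotics.IsBigO.of_bound C (Eventually.of_forall fun ε => ?_)⟩
  rw [Real.norm_of_nonneg (apply_nonneg _ _),
    Real.norm_of_nonneg (Finset.sum_nonneg fun i _ => apply_nonneg _ _)]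
  exact h _

lemma FinsetBounded.mem_moderateNets (hL : FinsetBounded p q L) {u : Ioc (0 : ℝ) 1 → E}
    (hu : u ∈ moderateNets p) : (fun ε => L (u ε)) ∈ moderateNets q := by
  intro j
  obtain ⟨s, hs⟩ := hL.isBigO (u := u) j
  choose N hN using hu
  refine ⟨s.sup N, hs.trans (Asymptotics.IsBigO.fun_sum fun i hi => (hN i).trans ?_)⟩
  refine Asymptotics.IsBigO.of_bound 1 (Eventually.of_forall fun ε => ?_)
  have h0 : (0 : ℝ) < ε := ε.2.1
  rw [one_mul, Real.norm_of_nonneg (zpow_nonneg h0.le _),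
    Real.norm_of_nonneg (zpow_nonneg h0.le _)]
  have : N i ≤ s.sup N := Finset.le_sup hi
  exact zpow_le_zpow_right_of_le_one₀ h0 ε.2.2 (by omega)

lemma FinsetBounded.mem_negligibleNets (hL : FinsetBounded p q L) {u : Ioc (0 : ℝ) 1 → E}
    (hu : u ∈ negligibleNets p) : (fun ε => L (u ε)) ∈ negligibleNets q := by
  intro j n
  obtain ⟨s, hs⟩ := hL.isBigO (u := u) j
  exact hs.trans (Asymptotics.IsBigO.fun_sum fun i _ => hu i n)

/-- The componentwise action of a linear map, on generalized functions. -/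
def inducedMap (hL : FinsetBounded p q L) : GeneralizedFunction p →ₗ[ℝ] GeneralizedFunction q :=
  Submodule.mapQ _ _
    ((L.compLeft (Ioc (0 : ℝ) 1)).restrict (p := moderateNets p) (q := moderateNets q)
      fun _ hu => hL.mem_moderateNets hu)
    fun _ hu => hL.mem_negligibleNets hu

lemma Represents.inducedMap (hL : FinsetBounded p q L) {u : Ioc (0 : ℝ) 1 → E}
    {U : GeneralizedFunction p} (h : Represents p u U) :
    Represents q (fun ε => L (u ε)) (inducedMap hL U) := by
  obtain ⟨hu, rfl⟩ := h
  exact ⟨hL.mem_moderateNets hu, rfl⟩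

lemma Represents.generalizedMap (hL : ∀ j, ∃ i, ∀ f, q j (L f) ≤ p i f)
    {u : Ioc (0 : ℝ) 1 → E} {U : GeneralizedFunction p} (h : Represents p u U) :
    Represents q (fun ε => L (u ε)) (generalizedMap p q L hL U) := by
  obtain ⟨hu, rfl⟩ := h
  have hL' : FinsetBounded p q L := fun j => by
    obtain ⟨i, hi⟩ := hL j
    exact ⟨1, {i}, by simpa using hi⟩
  exact ⟨hL'.mem_moderateNets hu, rfl⟩

lemma Represents.add {u v : Ioc (0 : ℝ) 1 → E} {U V : GeneralizedFunction p}
    (hu : Represents p u U) (hv : Represents p v V) :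
    Represents p (fun ε => u ε + v ε) (U + V) := by
  obtain ⟨hu, rfl⟩ := hu
  obtain ⟨hv, rfl⟩ := hv
  exact ⟨(moderateNets p).add_mem hu hv, rfl⟩

lemma Represents.smul {u : Ioc (0 : ℝ) 1 → E} {U : GeneralizedFunction p} (c : ℝ)
    (hu : Represents p u U) : Represents p (fun ε => c • u ε) (c • U) := by
  obtain ⟨hu, rfl⟩ := hu
  exact ⟨(moderateNets p).smul_mem c hu, rfl⟩

lemma represents_zero : Represents p (fun _ => 0) 0 := ⟨(moderateNets p).zero_mem, rfl⟩

lemma Represents.sum {ι : Type*} (s : Finset ι) {u : ι → Ioc (0 : ℝ) 1 → E}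
    {U : ι → GeneralizedFunction p} (hu : ∀ i ∈ s, Represents p (u i) (U i)) :
    Represents p (fun ε => ∑ i ∈ s, u i ε) (∑ i ∈ s, U i) := by
  classical
  induction s using Finset.induction_on with
  | empty => simpa using represents_zero
  | insert i s hi ih =>
    simp only [Finset.sum_insert hi]
    exact (hu i (Finset.mem_insert_self _ _)).add
      (ih fun j hj => hu j (Finset.mem_insert_of_mem hj))

lemma exists_represents (U : GeneralizedFunction p) : ∃ u, Represents p u U := by
  obtain ⟨⟨u, hu⟩, rfl⟩ := Submodule.Quotient.mk_surjective _ U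
  exact ⟨u, hu, rfl⟩

lemma Represents.sub_mem_negligibleNets {u v : Ioc (0 : ℝ) 1 → E} {U : GeneralizedFunction p}
    (hu : Represents p u U) (hv : Represents p v U) : u - v ∈ negligibleNets p := by
  obtain ⟨hu, rfl⟩ := hu
  obtain ⟨hv, h⟩ := hv
  have := (Submodule.Quotient.eq _).1 h.symm
  exact this

/-- Vanishing seminorms are required instead of equality of the nets because elements of `smoothOn
Ω` may differ outside of `Ω` without being distinguished by any seminorm. -/
lemma Represents.eq {u v : Ioc (0 : ℝ) 1 → E} {U V : GeneralizedFunction p}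
    (hu : Represents p u U) (hv : Represents p v V) (h : ∀ j ε, p j (u ε - v ε) = 0) : U = V := by
  obtain ⟨hu, rfl⟩ := hu
  obtain ⟨hv, rfl⟩ := hv
  refine (Submodule.Quotient.eq _).2 fun j n => ?_
  refine Asymptotics.IsBigO.of_bound 1 (Eventually.of_forall fun ε => ?_)
  have : p j ((u - v) ε) = 0 := h j ε
  change ‖p j ((u - v) ε)‖ ≤ _
  rw [this]
  simp

end Nets

/-! ### Association on one representative, and composition with a smooth function -/

section Spacetime

variable {Ω : Opens Minkowski}

lemma bddAbove_iteratedPartialDeriv (j : SmoothOnIndex Ω) (f : smoothOn Ω) : BddAbove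
    (range fun X : (j.1.1 : Set Minkowski) => |(iteratedPartialDeriv Ω j.2 f).1 X|) := by
  have hc : ContinuousOn (fun X => |(iteratedPartialDeriv Ω j.2 f).1 X|) j.1.1 :=
    ((iteratedPartialDeriv Ω j.2 f).2.continuousOn.mono j.1.2).abs
  have := j.1.1.isCompact.bddAbove_image hc
  rwa [image_eq_range] at this

lemma smoothOnSeminorm_def (j : SmoothOnIndex Ω) (f : smoothOn Ω) : smoothOnSeminorm Ω j f =
    ⨆ X : (j.1.1 : Set Minkowski), |(iteratedPartialDeriv Ω j.2 f).1 X| := rfl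

lemma abs_iteratedPartialDeriv_le (j : SmoothOnIndex Ω) (f : smoothOn Ω) {X : Minkowski}
    (hX : X ∈ j.1.1) : |(iteratedPartialDeriv Ω j.2 f).1 X| ≤ smoothOnSeminorm Ω j f :=
  le_ciSup (bddAbove_iteratedPartialDeriv j f) (⟨X, hX⟩ : (j.1.1 : Set Minkowski))

lemma partialDeriv_apply (μ : Fin 4) (f : smoothOn Ω) {X : Minkowski} (hX : X ∈ Ω) :
    (partialDeriv Ω μ f).1 X = fderiv ℝ f.1 X (Pi.single μ 1) :=
  indicator_of_mem (s := (Ω : Set Minkowski)) (f := fun X => fderiv ℝ f.1 X (Pi.single μ 1)) hX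

lemma partialDeriv_congr (μ : Fin 4) {f g : smoothOn Ω} (h : EqOn f.1 g.1 Ω) :
    EqOn (partialDeriv Ω μ f).1 (partialDeriv Ω μ g).1 Ω := by
  intro X hX
  have hX' : X ∈ Ω := hX
  rw [partialDeriv_apply μ f hX', partialDeriv_apply μ g hX',
    (h.eventuallyEq_of_mem (Ω.isOpen.mem_nhds hX)).fderiv_eq]

lemma iteratedPartialDeriv_congr (l : List (Fin 4)) {f g : smoothOn Ω} (h : EqOn f.1 g.1 Ω) :
    EqOn (iteratedPartialDeriv Ω l f).1 (iteratedPartialDeriv Ω l g).1 Ω := by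
  induction l generalizing f g with
  | nil => exact h
  | cons μ l ih => exact ih (partialDeriv_congr μ h)

lemma smoothOnSeminorm_congr (j : SmoothOnIndex Ω) {f g : smoothOn Ω} (h : EqOn f.1 g.1 Ω) :
    smoothOnSeminorm Ω j f = smoothOnSeminorm Ω j g := by
  rw [smoothOnSeminorm_def, smoothOnSeminorm_def]
  refine iSup_congr fun X => ?_
  rw [iteratedPartialDeriv_congr j.2 h (j.1.2 X.2)]

lemma colombeau_eq_of_eqOn {u v : Ioc (0 : ℝ) 1 → smoothOn Ω} {U V : Colombeau Ω}
    (hu : Represents (smoothOnSeminorm Ω) u U) (hv : Represents (smoothOnSeminorm Ω) v V)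
    (h : ∀ ε, EqOn (u ε).1 (v ε).1 Ω) : U = V := by
  refine hu.eq hv fun j ε => ?_
  rw [smoothOnSeminorm_congr j (g := 0), map_zero]
  intro X hX
  simp [h ε hX]

/-- An association in `𝒟'(Ω)` can be checked on one representative. -/
lemma associatedOn_of_represents {u : Ioc (0 : ℝ) 1 → smoothOn Ω} {U : Colombeau Ω}
    (hu : Represents (smoothOnSeminorm Ω) u U) {f : Minkowski → ℝ} (hf : ContinuousOn f Ω)
    (h : ∀ φ : 𝓓(Ω, ℝ), Tendsto (fun ε => ∫ x, (u ε).1 x * φ x) epsToZero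
      (𝓝 (∫ x, f x * φ x))) : AssociatedOn U f := by
  have hfl := hf.locallyIntegrableOn (μ := volume) Ω.isOpen.measurableSet
  refine ⟨hfl, fun v hv φ => ?_⟩
  rw [regularDistribution_apply hfl]
  have e (ε : Ioc (0 : ℝ) 1) : regularDistribution Ω (v ε).1 φ =
      (∫ x, (u ε).1 x * φ x) + ∫ x, (v ε - u ε).1 x * φ x := by
    rw [regularDistribution_apply
      ((smoothOn.continuousOn (v ε)).locallyIntegrableOn Ω.isOpen.measurableSet),
      ← integral_add (integrable_mul_test (smoothOn.continuousOn _) φ)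
        (integrable_mul_test (smoothOn.continuousOn _) φ)]
    refine integral_congr_ae (Eventually.of_forall fun x => ?_)
    simp only [Submodule.coe_sub, Pi.sub_apply]
    ring
  simp only [e]
  rw [← add_zero (∫ x, f x * φ x)]
  refine (h φ).add ?_
  -- Two representatives differ by a net whose supremum over the support of `φ` is `O(ε)`; no
  -- derivatives and no higher order are needed for the pairing with `φ` to vanish in the limit.
  let j : SmoothOnIndex Ω := (⟨⟨tsupport φ, φ.hasCompactSupport⟩, φ.tsupport_subset⟩, [])
  have hn : (fun ε => smoothOnSeminorm Ω j (v ε - u ε)) =O[epsToZero]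
      fun ε => (ε : ℝ) ^ 1 := hv.sub_mem_negligibleNets hu j 1
  have hn0 : Tendsto (fun ε => smoothOnSeminorm Ω j (v ε - u ε)) epsToZero (𝓝 0) :=
    hn.trans_tendsto (by simpa using tendsto_coe_epsToZero)
  have hlim : Tendsto (fun ε => smoothOnSeminorm Ω j (v ε - u ε) * ∫ x, |φ x|) epsToZero
      (𝓝 0) := by simpa using hn0.mul_const (∫ x, |φ x|)
  refine squeeze_zero_norm (fun ε => ?_) hlim
  have hφi : Integrable fun x => |φ x| :=
    (φ.continuous.integrable_of_hasCompactSupport φ.hasCompactSupport).abs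
  rw [← integral_const_mul]
  refine norm_integral_le_of_norm_le (hφi.const_mul _) (Eventually.of_forall fun x => ?_)
  rw [norm_mul, Real.norm_eq_abs, Real.norm_eq_abs]
  by_cases hx : x ∈ tsupport φ
  · exact mul_le_mul_of_nonneg_right (abs_iteratedPartialDeriv_le j (v ε - u ε) hx) (abs_nonneg _)
  · simp [image_eq_zero_of_notMem_tsupport hx]

lemma contDiff_iteratedDeriv (h : boundedSmooth) (k : ℕ) : ContDiff ℝ ∞ (iteratedDeriv k h.1) := by
  rw [iteratedDeriv_eq_iterate]
  exact h.2.1.iterate_deriv k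

/-- The map `h ↦ a · (h⁽ᵏ⁾ ∘ ξ)` on `W^{∞,∞}(ℝ)`. -/
def compMap (ξ a : smoothOn Ω) (k : ℕ) : boundedSmooth →ₗ[ℝ] smoothOn Ω where
  toFun h := ⟨fun X => a.1 X * iteratedDeriv k h.1 (ξ.1 X),
    ContDiffOn.mul a.2 ((contDiff_iteratedDeriv h k).comp_contDiffOn ξ.2)⟩
  map_add' h g := by
    ext X
    have : iteratedDeriv k (h + g).1 (ξ.1 X) = iteratedDeriv k h.1 (ξ.1 X) +
        iteratedDeriv k g.1 (ξ.1 X) := iteratedDeriv_add_of_smooth h.2.1 g.2.1 k _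
    change a.1 X * iteratedDeriv k (h + g).1 (ξ.1 X) =
      a.1 X * iteratedDeriv k h.1 (ξ.1 X) + a.1 X * iteratedDeriv k g.1 (ξ.1 X)
    rw [this, mul_add]
  map_smul' c h := by
    ext X
    have : iteratedDeriv k (c • h).1 (ξ.1 X) = c • iteratedDeriv k h.1 (ξ.1 X) :=
      iteratedDeriv_const_smul_field c h.1
    change a.1 X * iteratedDeriv k (c • h).1 (ξ.1 X) = c * (a.1 X * iteratedDeriv k h.1 (ξ.1 X))
    rw [this, smul_eq_mul, mul_left_comm]

lemma compMap_apply (ξ a : smoothOn Ω) (k : ℕ) (h : boundedSmooth) (X : Minkowski) :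
    (compMap ξ a k h).1 X = a.1 X * iteratedDeriv k h.1 (ξ.1 X) := rfl

lemma abs_iteratedDeriv_le (h : boundedSmooth) (k : ℕ) (s : ℝ) :
    |iteratedDeriv k h.1 s| ≤ boundedSmoothSeminorm k h := by
  obtain ⟨C, hC⟩ := h.2.2 k
  exact le_ciSup (f := fun x => |iteratedDeriv k h.1 x|)
    ⟨C, by rintro _ ⟨x, rfl⟩; exact hC x⟩ s

/-- By the Leibniz and chain rules, the family of maps `h ↦ a · h⁽ᵏ⁾(ξ)` is closed under
differentiation up to sums, which drives the induction in `finsetBounded_compMap`. -/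
lemma partialDeriv_compMap (ξ a : smoothOn Ω) (k : ℕ) (μ : Fin 4) (h : boundedSmooth) :
    EqOn (partialDeriv Ω μ (compMap ξ a k h)).1
      (compMap ξ (partialDeriv Ω μ a) k h + compMap ξ
        ⟨a.1 * (partialDeriv Ω μ ξ).1, ContDiffOn.mul a.2 (partialDeriv Ω μ ξ).2⟩ (k + 1) h).1
      Ω := by
  intro X hX
  have hX' : X ∈ Ω := hX
  have hs := contDiff_iteratedDeriv h k
  have ha := (smoothOn_differentiableAt a hX').hasFDerivAt
  have hξ := (smoothOn_differentiableAt ξ hX').hasFDerivAt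
  have hd := ((hs.differentiable (by simp)) (ξ.1 X)).hasDerivAt
  rw [← iteratedDeriv_succ] at hd
  rw [partialDeriv_apply μ _ hX',
    show (compMap ξ a k h).1 = a.1 * (iteratedDeriv k h.1 ∘ ξ.1) from rfl,
    (ha.mul (hd.comp_hasFDerivAt X hξ)).fderiv]
  simp only [Submodule.coe_add, Pi.add_apply, compMap_apply, partialDeriv_apply μ _ hX',
    Pi.mul_apply]
  simp
  ring

/-- Induction on the number of derivatives, with `a` and `k` varying. Without derivatives, the bound
is the supremum of `|a|` over the compact set times the global bound of `h⁽ᵏ⁾`. -/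
lemma finsetBounded_compMap (ξ a : smoothOn Ω) (k : ℕ) :
    FinsetBounded boundedSmoothSeminorm (smoothOnSeminorm Ω) (compMap ξ a k) := by
  rintro ⟨K, l⟩
  induction l generalizing a k with
  | nil =>
    refine ⟨smoothOnSeminorm Ω (K, []) a, {k}, fun h => ?_⟩
    rw [smoothOnSeminorm_def, Finset.sum_singleton]
    refine Real.iSup_le (fun X => ?_) (mul_nonneg (apply_nonneg _ _) (apply_nonneg _ _))
    change |(compMap ξ a k h).1 X| ≤ _
    rw [compMap_apply, abs_mul]
    exact mul_le_mul (abs_iteratedPartialDeriv_le (K, []) a X.2) (abs_iteratedDeriv_le h k _)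
      (abs_nonneg _) (apply_nonneg _ _)
  | cons μ l ih =>
    refine exists_bound_of_le_add (fun h => ?_) (ih (partialDeriv Ω μ a) k) (ih
      ⟨a.1 * (partialDeriv Ω μ ξ).1, ContDiffOn.mul a.2 (partialDeriv Ω μ ξ).2⟩ (k + 1))
    have h1 : smoothOnSeminorm Ω (K, μ :: l) (compMap ξ a k h) =
        smoothOnSeminorm Ω (K, l) (partialDeriv Ω μ (compMap ξ a k h)) := rfl
    rw [h1, smoothOnSeminorm_congr _ (partialDeriv_compMap ξ a k μ h)]
    exact map_add_le_add _ _ _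

end Spacetime

/-! ### Algebra of the Lorentz product -/

section Lorentz

lemma lorentz_comm (x y : Minkowski) : lorentz x y = lorentz y x :=
  Finset.sum_congr rfl fun _ _ => by ring

lemma lorentz_sub_right (x y z : Minkowski) : lorentz x (y - z) = lorentz x y - lorentz x z := by
  simp only [lorentz, ← Finset.sum_sub_distrib]
  exact Finset.sum_congr rfl fun _ _ => by simp; ring

lemma lorentz_smul_right (c : ℝ) (x y : Minkowski) : lorentz x (c • y) = c * lorentz x y := by
  simp only [lorentz, Finset.mul_sum]
  exact Finset.sum_congr rfl fun _ _ => by simp; ring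

lemma lorentz_smul_left (c : ℝ) (x y : Minkowski) : lorentz (c • x) y = c * lorentz x y := by
  rw [lorentz_comm, lorentz_smul_right, lorentz_comm]

lemma lorentz_single (x : Minkowski) (μ : Fin 4) : lorentz x (Pi.single μ 1) = lower x μ := by
  simp [lorentz, _root_.lower, Pi.single_apply]

lemma lower_smul (c : ℝ) (x : Minkowski) (μ : Fin 4) : lower (c • x) μ = c * lower x μ := by
  simp [_root_.lower]; ring

lemma metricSign_mul_self (μ : Fin 4) : metricSign μ * metricSign μ = 1 := by
  fin_cases μ <;> simp [metricSign]

lemma sum_metricSign_mul_lower (x y : Minkowski) :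
    ∑ μ, metricSign μ * (lower x μ * lower y μ) = lorentz x y := by
  refine Finset.sum_congr rfl fun μ _ => ?_
  simp only [_root_.lower]
  linear_combination metricSign μ * x μ * y μ * metricSign_mul_self μ

end Lorentz

/-! ### Uniqueness and smoothness of the retarded time -/

section RetardedTime

variable {Z : ℝ → Minkowski}

lemma IsWorldLine.hasDerivAt (hZ : IsWorldLine Z) (τ : ℝ) : HasDerivAt Z (deriv Z τ) τ :=
  (hZ.smooth.differentiable (by simp) τ).hasDerivAt

/-- The function `τ ↦ r·Z(τ)` is strictly increasing, since a future-directed null vector and the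
four-velocity have a positive product. -/
lemma IsWorldLine.lorentz_sub_pos (hZ : IsWorldLine Z) {r : Minkowski} (hr : lorentz r r = 0)
    (hr0 : 0 < r 0) {s t : ℝ} (hst : s < t) : 0 < lorentz r (Z t - Z s) := by
  have hd (τ : ℝ) : HasDerivAt (fun τ => lorentz r (Z τ)) (lorentz r (deriv Z τ)) τ := by
    unfold lorentz
    exact HasDerivAt.fun_sum fun μ _ => (hasDerivAt_pi.1 (hZ.hasDerivAt τ) μ).const_mul _
  have hm : StrictMono fun τ => lorentz r (Z τ) := by
    refine strictMono_of_deriv_pos fun τ => ?_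
    rw [(hd τ).deriv, lorentz_comm]
    exact lorentz_pos_of_timelike_of_null (hZ.eigentime τ) (hZ.future τ) hr hr0
  rw [lorentz_sub_right]
  linarith [hm hst]

/-- If `s < t` were both retarded times, with null vectors `R_s` and `R_t`, then multiplying `Z(t) -
Z(s) = R_s - R_t` by each of them would make both `-R_s·R_t` and `R_s·R_t` positive. -/
lemma IsRetardedTime.unique (hZ : IsWorldLine Z) {X : Minkowski} {s t : ℝ}
    (hs : IsRetardedTime Z X s) (ht : IsRetardedTime Z X t) : s = t := by
  have key {s t : ℝ} (hs : IsRetardedTime Z X s) (ht : IsRetardedTime Z X t) : ¬ s < t := by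
    intro hst
    have h1 := hZ.lorentz_sub_pos hs.1 hs.2 hst
    have h2 := hZ.lorentz_sub_pos ht.1 ht.2 hst
    have e : Z t - Z s = (X - Z s) - (X - Z t) := by abel
    rw [e, lorentz_sub_right, hs.1] at h1
    rw [e, lorentz_sub_right, ht.1, lorentz_comm] at h2
    linarith
  exact le_antisymm (not_lt.1 (key ht hs)) (not_lt.1 (key hs ht))

/-- A point `Z(σ)` has no retarded time `τ`: for `σ ≠ τ` the strict monotonicity contradicts `R·R =
0`, and for `σ = τ` the time component of `R` is zero. Conversely, a null vector with zero time
component is zero, so off the world line the time component is strictly positive. -/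
lemma retardedDomain_eq_compl_range (hZ : IsWorldLine Z)
    (h : ∀ X, ∃ τ, lorentz (X - Z τ) (X - Z τ) = 0 ∧ 0 ≤ (X - Z τ) 0) :
    (retardedDomain Z hZ : Set Minkowski) = (range Z)ᶜ := by
  ext X
  constructor
  · rintro ⟨τ, hτ⟩ ⟨σ, rfl⟩
    rcases lt_trichotomy σ τ with hlt | rfl | hlt
    · have := hZ.lorentz_sub_pos hτ.1 hτ.2 hlt
      rw [← neg_sub (Z σ) (Z τ), ← neg_one_smul ℝ, lorentz_smul_right, hτ.1] at this
      simp at this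
    · have := hτ.2
      simp at this
    · have := hZ.lorentz_sub_pos hτ.1 hτ.2 hlt
      rw [hτ.1] at this
      exact lt_irrefl _ this
  · intro hX
    obtain ⟨τ, h0, h1⟩ := h X
    refine ⟨τ, h0, lt_of_le_of_ne h1 fun h2 => hX ⟨τ, ?_⟩⟩
    rw [eq_comm, ← sub_eq_zero]
    generalize X - Z τ = r at *
    simp only [lorentz, metricSign, Fin.sum_univ_four, Matrix.cons_val, ← h2] at h0
    ext μ
    fin_cases μ
    · exact h2.symm
    · exact pow_eq_zero_iff two_ne_zero |>.1 (by
        nlinarith [sq_nonneg (r 1), sq_nonneg (r 2), sq_nonneg (r 3)] : r 1 ^ 2 = 0)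
    · exact pow_eq_zero_iff two_ne_zero |>.1 (by
        nlinarith [sq_nonneg (r 1), sq_nonneg (r 2), sq_nonneg (r 3)] : r 2 ^ 2 = 0)
    · exact pow_eq_zero_iff two_ne_zero |>.1 (by
        nlinarith [sq_nonneg (r 1), sq_nonneg (r 2), sq_nonneg (r 3)] : r 3 ^ 2 = 0)

lemma isRetardedTime_retardedTime (hZ : IsWorldLine Z) {X : Minkowski}
    (hX : X ∈ retardedDomain Z hZ) : IsRetardedTime Z X (retardedTime Z X) :=
  Classical.epsilon_spec hX

lemma retXi_pos (hZ : IsWorldLine Z) {X : Minkowski} (hX : X ∈ retardedDomain Z hZ) :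
    0 < retXi Z X :=
  lorentz_pos_of_timelike_of_null (hZ.eigentime _) (hZ.future _)
    (isRetardedTime_retardedTime hZ hX).1 (isRetardedTime_retardedTime hZ hX).2

/-- Implicit function theorem for `(X - Z(τ))² = 0`, whose `τ`-derivative is `-2 ξ̃ ≠ 0`. -/
lemma contDiffOn_retardedTime (hZ : IsWorldLine Z) :
    ContDiffOn ℝ ∞ (retardedTime Z) (retardedDomain Z hZ) := by
  intro X hX
  have hτ := isRetardedTime_retardedTime hZ hX
  set τ := retardedTime Z X with hτdef
  have hZs := hZ.smooth
  let f : Minkowski × ℝ → ℝ := fun q => lorentz (q.1 - Z q.2) (q.1 - Z q.2)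
  have hf : ContDiff ℝ ∞ f := by
    have (μ : Fin 4) : ContDiff ℝ ∞ fun q : Minkowski × ℝ => (q.1 - Z q.2) μ :=
      contDiff_pi.1 (contDiff_fst.sub (hZs.comp contDiff_snd)) μ
    exact ContDiff.sum fun μ _ => (contDiff_const.mul (this μ)).mul (this μ)
  have hfu := hf.contDiffAt (x := (X, τ))
  have hinv : (fderiv ℝ f (X, τ) ∘L .inr ℝ Minkowski ℝ).IsInvertible := by
    have hd : ∀ μ, HasDerivAt (fun s => (X - Z s) μ) (-(deriv Z τ μ)) τ := fun μ => by
      simpa using (hasDerivAt_pi.1 (hZ.hasDerivAt τ) μ).const_sub (X μ)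
    have hder : HasDerivAt (fun s => f (X, s)) (-2 * lorentz (deriv Z τ) (X - Z τ)) τ := by
      have := HasDerivAt.fun_sum (u := Finset.univ) fun μ _ =>
        ((hd μ).const_mul (metricSign μ)).mul (hd μ)
      refine this.congr_deriv ?_
      rw [lorentz, Finset.mul_sum]
      exact Finset.sum_congr rfl fun μ _ => by ring
    have hder' : HasDerivAt (fun s => f (X, s)) (fderiv ℝ f (X, τ) (0, 1)) τ :=
      ((hf.differentiable (by simp)) (X, τ)).hasFDerivAt.comp_hasDerivAt τ
        ((hasDerivAt_const τ X).prodMk (hasDerivAt_id τ))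
    have hpos := retXi_pos hZ hX
    have hne : fderiv ℝ f (X, τ) (0, 1) ≠ 0 := by
      rw [hder'.unique hder]
      simp only [retXi, retVelocity, retR, ← hτdef] at hpos
      linarith
    refine ⟨ContinuousLinearEquiv.unitsEquivAut ℝ (Units.mk0 _ hne), ?_⟩
    ext
    simp
  have hn : (∞ : ℕ∞ω) ≠ 0 := by simp
  have hσ := hfu.contDiffAt_implicitFunction hn hinv
  have hσ0 := hfu.implicitFunction_apply_self hn hinv
  have hσ1 := hfu.eventually_apply_implicitFunction hn hinv
  set σ := hfu.implicitFunction hn hinv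
  have hc : ContinuousAt (fun Y => (Y - Z (σ Y)) 0) X := by
    have h1 : ContinuousAt (fun Y => Y - Z (σ Y)) X :=
      continuousAt_id.sub (hZs.continuous.continuousAt.comp hσ.continuousAt)
    exact (continuous_apply 0).continuousAt.comp h1
  have hpos : ∀ᶠ Y in 𝓝 X, 0 < (Y - Z (σ Y)) 0 := by
    refine hc.eventually (lt_mem_nhds ?_)
    simp only [show σ X = τ from hσ0]
    exact hτ.2
  -- The implicit solution stays future-directed near `X`, so uniqueness identifies it with the
  -- retarded time.
  have heq : retardedTime Z =ᶠ[𝓝 X] σ := by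
    filter_upwards [hσ1, hpos] with Y h1 h2
    have h3 : IsRetardedTime Z Y (σ Y) := ⟨h1.trans hτ.1, h2⟩
    exact IsRetardedTime.unique hZ (isRetardedTime_retardedTime hZ ⟨_, h3⟩) h3
  exact (hσ.congr_of_eventuallyEq heq).contDiffWithinAt

lemma contDiff_deriv_worldLine (hZ : IsWorldLine Z) : ContDiff ℝ ∞ (deriv Z) :=
  (contDiff_infty_iff_deriv.1 hZ.smooth).2

lemma contDiffOn_retR (hZ : IsWorldLine Z) (μ : Fin 4) :
    ContDiffOn ℝ ∞ (fun X => retR Z X μ) (retardedDomain Z hZ) :=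
  contDiffOn_pi.1 (contDiffOn_id.sub (hZ.smooth.comp_contDiffOn (contDiffOn_retardedTime hZ))) μ

lemma contDiffOn_retVelocity (hZ : IsWorldLine Z) (μ : Fin 4) :
    ContDiffOn ℝ ∞ (fun X => retVelocity Z X μ) (retardedDomain Z hZ) :=
  contDiffOn_pi.1 ((contDiff_deriv_worldLine hZ).comp_contDiffOn (contDiffOn_retardedTime hZ)) μ

lemma contDiffOn_retAcceleration (hZ : IsWorldLine Z) (μ : Fin 4) :
    ContDiffOn ℝ ∞ (fun X => deriv (deriv Z) (retardedTime Z X) μ) (retardedDomain Z hZ) :=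
  contDiffOn_pi.1 ((contDiff_infty_iff_deriv.1 (contDiff_deriv_worldLine hZ)).2.comp_contDiffOn
    (contDiffOn_retardedTime hZ)) μ

lemma contDiffOn_lorentz {s : Set Minkowski} {u v : Minkowski → Minkowski}
    (hu : ∀ μ, ContDiffOn ℝ ∞ (fun X => u X μ) s) (hv : ∀ μ, ContDiffOn ℝ ∞ (fun X => v X μ) s) :
    ContDiffOn ℝ ∞ (fun X => lorentz (u X) (v X)) s :=
  ContDiffOn.sum fun μ _ => (contDiffOn_const.mul (hu μ)).mul (hv μ)

lemma contDiffOn_retXi (hZ : IsWorldLine Z) : ContDiffOn ℝ ∞ (retXi Z) (retardedDomain Z hZ) :=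
  contDiffOn_lorentz (contDiffOn_retVelocity hZ) (contDiffOn_retR hZ)

lemma contDiffOn_retK (hZ : IsWorldLine Z) (μ : Fin 4) :
    ContDiffOn ℝ ∞ (fun X => retK Z X μ) (retardedDomain Z hZ) :=
  ((contDiffOn_retXi hZ).inv fun _ hX => (retXi_pos hZ hX).ne').mul (contDiffOn_retR hZ μ)

lemma contDiffOn_retKappa (hZ : IsWorldLine Z) :
    ContDiffOn ℝ ∞ (retKappa Z) (retardedDomain Z hZ) :=
  contDiffOn_lorentz (contDiffOn_retAcceleration hZ) (contDiffOn_retK hZ)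

end RetardedTime

/-! ### Calculus of partial derivatives -/

section PartialDerivatives

/-- `f` is differentiable at `X`, with partial derivative `c` in the direction `μ`. -/
def HasPartialAt (μ : Fin 4) (f : Minkowski → ℝ) (c : ℝ) (X : Minkowski) : Prop :=
  DifferentiableAt ℝ f X ∧ fderiv ℝ f X (Pi.single μ 1) = c

variable {μ : Fin 4} {f g : Minkowski → ℝ} {c d : ℝ} {X : Minkowski}

lemma HasFDerivAt.hasPartialAt {f' : Minkowski →L[ℝ] ℝ} (hf : HasFDerivAt f f' X) :
    HasPartialAt μ f (f' (Pi.single μ 1)) X := ⟨hf.differentiableAt, by rw [hf.fderiv]⟩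

lemma HasPartialAt.congr_value (hf : HasPartialAt μ f c X) (h : c = d) : HasPartialAt μ f d X :=
  h ▸ hf

lemma HasPartialAt.congr_of_eventuallyEq (hf : HasPartialAt μ f c X) (h : g =ᶠ[𝓝 X] f) :
    HasPartialAt μ g c X :=
  ⟨hf.1.congr_of_eventuallyEq h, by rw [h.fderiv_eq]; exact hf.2⟩

lemma hasPartialAt_const (a : ℝ) : HasPartialAt μ (fun _ => a) 0 X := by
  simpa using (hasFDerivAt_const a X).hasPartialAt (μ := μ)

lemma HasPartialAt.add (hf : HasPartialAt μ f c X) (hg : HasPartialAt μ g d X) :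
    HasPartialAt μ (fun Y => f Y + g Y) (c + d) X := by
  simpa [hf.2, hg.2] using (hf.1.hasFDerivAt.fun_add hg.1.hasFDerivAt).hasPartialAt (μ := μ)

lemma HasPartialAt.sub (hf : HasPartialAt μ f c X) (hg : HasPartialAt μ g d X) :
    HasPartialAt μ (fun Y => f Y - g Y) (c - d) X := by
  simpa [hf.2, hg.2] using (hf.1.hasFDerivAt.fun_sub hg.1.hasFDerivAt).hasPartialAt (μ := μ)

lemma HasPartialAt.mul (hf : HasPartialAt μ f c X) (hg : HasPartialAt μ g d X) :
    HasPartialAt μ (fun Y => f Y * g Y) (c * g X + f X * d) X := by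
  refine ((hf.1.hasFDerivAt.fun_mul hg.1.hasFDerivAt).hasPartialAt (μ := μ)).congr_value ?_
  simp [hf.2, hg.2]
  ring

lemma HasPartialAt.const_mul (a : ℝ) (hf : HasPartialAt μ f c X) :
    HasPartialAt μ (fun Y => a * f Y) (a * c) X := by
  simpa using (hasPartialAt_const a).mul hf

lemma HasPartialAt.comp {k : ℝ → ℝ} {k' : ℝ} (hk : HasDerivAt k k' (f X))
    (hf : HasPartialAt μ f c X) : HasPartialAt μ (fun Y => k (f Y)) (k' * c) X := by
  refine ((hk.comp_hasFDerivAt X hf.1.hasFDerivAt).hasPartialAt (μ := μ)).congr_value ?_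
  simp [hf.2]

lemma HasPartialAt.inv (hf : HasPartialAt μ f c X) (h0 : f X ≠ 0) :
    HasPartialAt μ (fun Y => (f Y)⁻¹) (-c / f X ^ 2) X :=
  (hf.comp (k := fun s => s⁻¹) (hasDerivAt_inv h0)).congr_value (by ring)

lemma HasPartialAt.sum {ι : Type*} (s : Finset ι) {f : ι → Minkowski → ℝ} {c : ι → ℝ}
    (hf : ∀ i ∈ s, HasPartialAt μ (f i) (c i) X) :
    HasPartialAt μ (fun Y => ∑ i ∈ s, f i Y) (∑ i ∈ s, c i) X := by
  refine ((HasFDerivAt.fun_sum fun i hi => (hf i hi).1.hasFDerivAt).hasPartialAt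
    (μ := μ)).congr_value ?_
  rw [sum_apply]
  exact Finset.sum_congr rfl fun i hi => (hf i hi).2

lemma HasPartialAt.lorentz {u v : Minkowski → Minkowski} {u' v' : Minkowski}
    (hu : ∀ ν, HasPartialAt μ (fun Y => u Y ν) (u' ν) X)
    (hv : ∀ ν, HasPartialAt μ (fun Y => v Y ν) (v' ν) X) :
    HasPartialAt μ (fun Y => lorentz (u Y) (v Y)) (lorentz u' (v X) + lorentz (u X) v') X := by
  refine (HasPartialAt.sum Finset.univ fun ν _ =>
    ((hu ν).const_mul (metricSign ν)).mul (hv ν)).congr_value ?_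
  simp only [_root_.lorentz, ← Finset.sum_add_distrib]

lemma HasPartialAt.lower {u : Minkowski → Minkowski} {u' : Minkowski}
    (hu : ∀ ν, HasPartialAt μ (fun Y => u Y ν) (u' ν) X) (α : Fin 4) :
    HasPartialAt μ (fun Y => lower (u Y) α) (lower u' α) X :=
  (hu α).const_mul (metricSign α)

end PartialDerivatives

/-! ### Derivatives of the retarded quantities and the wave operator -/

section RetardedDerivatives

variable {Z : ℝ → Minkowski} {X : Minkowski}

lemma differentiableAt_retardedTime (hZ : IsWorldLine Z) (hX : X ∈ retardedDomain Z hZ) :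
    DifferentiableAt ℝ (retardedTime Z) X :=
  ((contDiffOn_retardedTime hZ).contDiffAt
    ((retardedDomain Z hZ).isOpen.mem_nhds hX)).differentiableAt (by simp)

/-- `∂_μ τ_r = K̃_μ`. -/
lemma hasPartialAt_retardedTime (hZ : IsWorldLine Z) (hX : X ∈ retardedDomain Z hZ)
    (μ : Fin 4) : HasPartialAt μ (retardedTime Z) (lower (retK Z X) μ) X := by
  refine ⟨differentiableAt_retardedTime hZ hX, ?_⟩
  set k := fderiv ℝ (retardedTime Z) X (Pi.single μ 1) with hk
  have hτ : HasPartialAt μ (retardedTime Z) k X := ⟨differentiableAt_retardedTime hZ hX, rfl⟩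
  have hR (ν : Fin 4) : HasPartialAt μ (fun Y => retR Z Y ν)
      ((Pi.single μ (1 : ℝ) - k • retVelocity Z X : Minkowski) ν) X := by
    have h1 : HasPartialAt μ (fun Y : Minkowski => Y ν) ((Pi.single μ (1 : ℝ) : Minkowski) ν) X :=
      (ContinuousLinearMap.proj (R := ℝ) (φ := fun _ : Fin 4 => ℝ) ν).hasFDerivAt.hasPartialAt
    refine (h1.sub (hτ.comp (hasDerivAt_pi.1 (hZ.hasDerivAt _) ν))).congr_value ?_
    simp [retVelocity, mul_comm]
  -- Differentiating `R̃·R̃ = 0`, which holds identically on the domain, gives `R̃_μ - k ξ̃ = 0` and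
  -- determines `k`.
  have h0 : HasPartialAt μ (fun Y => lorentz (retR Z Y) (retR Z Y)) 0 X := by
    refine (hasPartialAt_const 0).congr_of_eventuallyEq ?_
    filter_upwards [(retardedDomain Z hZ).isOpen.mem_nhds hX] with Y hY
    exact (isRetardedTime_retardedTime hZ hY).1
  have h1 := (HasPartialAt.lorentz hR hR).2.symm.trans h0.2
  rw [lorentz_comm _ (retR Z X), lorentz_sub_right, lorentz_smul_right, lorentz_single,
    lorentz_comm _ (retVelocity Z X)] at h1
  have hpos := retXi_pos hZ hX
  rw [retK, lower_smul]
  change _ - k * retXi Z X + (_ - k * retXi Z X) = 0 at h1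
  field_simp
  linarith

/-- `∂_μ R̃ = e_μ - K̃_μ Ż`. -/
lemma hasPartialAt_retR (hZ : IsWorldLine Z) (hX : X ∈ retardedDomain Z hZ) (μ ν : Fin 4) :
    HasPartialAt μ (fun Y => retR Z Y ν)
      ((Pi.single μ (1 : ℝ) - lower (retK Z X) μ • retVelocity Z X : Minkowski) ν) X := by
  have h1 : HasPartialAt μ (fun Y : Minkowski => Y ν) ((Pi.single μ (1 : ℝ) : Minkowski) ν) X :=
    (ContinuousLinearMap.proj (R := ℝ) (φ := fun _ : Fin 4 => ℝ) ν).hasFDerivAt.hasPartialAt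
  refine (h1.sub ((hasPartialAt_retardedTime hZ hX μ).comp
    (hasDerivAt_pi.1 (hZ.hasDerivAt _) ν))).congr_value ?_
  simp [retVelocity, mul_comm]

/-- Derivatives of functions of the retarded time. -/
lemma hasPartialAt_comp_retardedTime (hZ : IsWorldLine Z) (hX : X ∈ retardedDomain Z hZ)
    {W : ℝ → Minkowski} (hW : Differentiable ℝ W) (μ ν : Fin 4) :
    HasPartialAt μ (fun Y => W (retardedTime Z Y) ν)
      ((lower (retK Z X) μ • deriv W (retardedTime Z X)) ν) X := by
  refine ((hasPartialAt_retardedTime hZ hX μ).comp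
    (hasDerivAt_pi.1 (hW _).hasDerivAt ν)).congr_value ?_
  simp [mul_comm]

/-- The partial derivative `∂_μ ξ̃ = (ξ̃ κ̃ - 1) K̃_μ + Ż_μ`. -/
def gradXi (Z : ℝ → Minkowski) (μ : Fin 4) (X : Minkowski) : ℝ :=
  (lorentz (deriv (deriv Z) (retardedTime Z X)) (retR Z X) - 1) * lower (retK Z X) μ +
    lower (retVelocity Z X) μ

lemma hasPartialAt_retXi (hZ : IsWorldLine Z) (hX : X ∈ retardedDomain Z hZ) (μ : Fin 4) :
    HasPartialAt μ (retXi Z) (gradXi Z μ X) X := by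
  refine (HasPartialAt.lorentz (u := retVelocity Z) (hasPartialAt_comp_retardedTime hZ hX
    ((contDiff_deriv_worldLine hZ).differentiable (by simp)) μ)
    (hasPartialAt_retR hZ hX μ)).congr_value ?_
  rw [lorentz_smul_left, lorentz_sub_right, lorentz_smul_right, lorentz_single, gradXi,
    show lorentz (retVelocity Z X) (retVelocity Z X) = 1 from hZ.eigentime _]
  ring

lemma lorentz_retR_retR (hZ : IsWorldLine Z) (hX : X ∈ retardedDomain Z hZ) :
    lorentz (retR Z X) (retR Z X) = 0 := (isRetardedTime_retardedTime hZ hX).1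

lemma lorentz_retVelocity_retK (hZ : IsWorldLine Z) (hX : X ∈ retardedDomain Z hZ) :
    lorentz (retVelocity Z X) (retK Z X) = 1 := by
  rw [retK, lorentz_smul_right]
  exact inv_mul_cancel₀ (retXi_pos hZ hX).ne'

lemma lorentz_retK_retK (hZ : IsWorldLine Z) (hX : X ∈ retardedDomain Z hZ) :
    lorentz (retK Z X) (retK Z X) = 0 := by
  rw [retK, lorentz_smul_right, lorentz_smul_left, lorentz_retR_retR hZ hX]
  simp

lemma sum_mul_lower (x y : Minkowski) : ∑ μ, x μ * lower y μ = lorentz x y :=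
  Finset.sum_congr rfl fun μ _ => by simp only [_root_.lower]; ring

/-- `K̃^μ ∂_μ ξ̃ = 1`. -/
lemma fderiv_retXi_retK (hZ : IsWorldLine Z) (hX : X ∈ retardedDomain Z hZ) :
    fderiv ℝ (retXi Z) X (retK Z X) = 1 := by
  have : retK Z X = ∑ μ, retK Z X μ • (Pi.single μ (1 : ℝ) : Minkowski) := by
    simpa using (pi_eq_sum_univ' (retK Z X) : _)
  rw [this, map_sum]
  simp only [map_smul, smul_eq_mul, (hasPartialAt_retXi hZ hX _).2, gradXi, mul_add,
    Finset.sum_add_distrib]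
  simp only [mul_left_comm (retK Z X _), ← Finset.mul_sum, sum_mul_lower]
  rw [lorentz_retK_retK hZ hX, lorentz_comm (retK Z X), lorentz_retVelocity_retK hZ hX]
  simp

/-- The partial derivative `∂_μ K̃_μ` (no summation). -/
def gradK (Z : ℝ → Minkowski) (μ : Fin 4) (X : Minkowski) : ℝ :=
  (metricSign μ - lower (retVelocity Z X) μ * lower (retK Z X) μ - lower (retK Z X) μ *
    gradXi Z μ X) / retXi Z X

lemma hasPartialAt_lower_retK (hZ : IsWorldLine Z) (hX : X ∈ retardedDomain Z hZ) (μ : Fin 4) :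
    HasPartialAt μ (fun Y => lower (retK Z Y) μ) (gradK Z μ X) X := by
  have hpos := retXi_pos hZ hX
  have := ((hasPartialAt_retXi hZ hX μ).inv hpos.ne').mul
    (HasPartialAt.lower (hasPartialAt_retR hZ hX μ) μ)
  refine (this.congr_of_eventuallyEq (Eventually.of_forall fun Y => ?_)).congr_value ?_
  · exact lower_smul _ _ _
  · simp only [gradK, retK, lower_smul]
    simp [_root_.lower]
    field_simp
    ring

/-- The partial derivative `∂_μ Φ_α`. -/
def gradPhi (e : ℝ) (Z : ℝ → Minkowski) (h : ℝ → ℝ) (α μ : Fin 4) (X : Minkowski) : ℝ :=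
  e / 2 * ((lower (Pi.single μ 1) α - lower (retK Z X) μ * lower (retVelocity Z X) α) *
    h (retXi Z X) + lower (retR Z X) α * (deriv h (retXi Z X) * gradXi Z μ X))

lemma lower_sub (x y : Minkowski) (α : Fin 4) : lower (x - y) α = lower x α - lower y α := by
  simp [_root_.lower]; ring

lemma hasPartialAt_phiOf (hZ : IsWorldLine Z) (hX : X ∈ retardedDomain Z hZ) {h : ℝ → ℝ}
    (hh : Differentiable ℝ h) (e : ℝ) (α μ : Fin 4) :
    HasPartialAt μ (phiOf e Z h α) (gradPhi e Z h α μ X) X := by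
  have := ((HasPartialAt.lower (hasPartialAt_retR hZ hX μ) α).const_mul (e / 2)).mul
    ((hasPartialAt_retXi hZ hX μ).comp (hh _).hasDerivAt)
  refine this.congr_value ?_
  rw [gradPhi, lower_sub, lower_smul]
  ring

/-- The partial derivative `∂_μ ∂_μ ξ̃` (no summation). -/
def hessXi (Z : ℝ → Minkowski) (μ : Fin 4) (X : Minkowski) : ℝ :=
  ((lorentz (deriv (deriv (deriv Z)) (retardedTime Z X)) (retR Z X) -
      lorentz (deriv (deriv Z) (retardedTime Z X)) (retVelocity Z X)) * lower (retK Z X) μ +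
    lower (deriv (deriv Z) (retardedTime Z X)) μ) * lower (retK Z X) μ +
  (lorentz (deriv (deriv Z) (retardedTime Z X)) (retR Z X) - 1) * gradK Z μ X +
  lower (retK Z X) μ * lower (deriv (deriv Z) (retardedTime Z X)) μ

lemma hasPartialAt_gradXi (hZ : IsWorldLine Z) (hX : X ∈ retardedDomain Z hZ) (μ : Fin 4) :
    HasPartialAt μ (gradXi Z μ) (hessXi Z μ X) X := by
  have h2 := (contDiff_infty_iff_deriv.1 (contDiff_deriv_worldLine hZ)).2
  have hA := HasPartialAt.lorentz (u := fun Y => deriv (deriv Z) (retardedTime Z Y))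
    (hasPartialAt_comp_retardedTime hZ hX (h2.differentiable (by simp)) μ)
    (hasPartialAt_retR hZ hX μ)
  have hV := HasPartialAt.lower (u := retVelocity Z) (hasPartialAt_comp_retardedTime hZ hX
    ((contDiff_deriv_worldLine hZ).differentiable (by simp)) μ) μ
  refine (((hA.sub (hasPartialAt_const 1)).mul (hasPartialAt_lower_retK hZ hX μ)).add
    hV).congr_value ?_
  rw [hessXi, lorentz_smul_left, lorentz_sub_right, lorentz_smul_right, lorentz_single, lower_smul]
  ring

/-- The partial derivative `∂_μ ∂_μ Φ_α` (no summation). -/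
def hessPhi (e : ℝ) (Z : ℝ → Minkowski) (h : ℝ → ℝ) (α μ : Fin 4) (X : Minkowski) : ℝ :=
  e / 2 * (-(gradK Z μ X * lower (retVelocity Z X) α + lower (retK Z X) μ *
      (lower (retK Z X) μ * lower (deriv (deriv Z) (retardedTime Z X)) α)) * h (retXi Z X) +
    2 * (lower (Pi.single μ 1) α - lower (retK Z X) μ * lower (retVelocity Z X) α) *
      (deriv h (retXi Z X) * gradXi Z μ X) +
    lower (retR Z X) α * (deriv (deriv h) (retXi Z X) * gradXi Z μ X ^ 2 +
      deriv h (retXi Z X) * hessXi Z μ X))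

lemma hasPartialAt_gradPhi (hZ : IsWorldLine Z) (hX : X ∈ retardedDomain Z hZ) {h : ℝ → ℝ}
    (hh : ContDiff ℝ ∞ h) (e : ℝ) (α μ : Fin 4) :
    HasPartialAt μ (gradPhi e Z h α μ) (hessPhi e Z h α μ X) X := by
  have hh' := (contDiff_infty_iff_deriv.1 hh).2
  have hV := HasPartialAt.lower (u := retVelocity Z) (hasPartialAt_comp_retardedTime hZ hX
    ((contDiff_deriv_worldLine hZ).differentiable (by simp)) μ) α
  have hξ := hasPartialAt_retXi hZ hX μ
  have h1 := ((hasPartialAt_const (lower (Pi.single μ 1) α)).sub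
    ((hasPartialAt_lower_retK hZ hX μ).mul hV)).mul
      (hξ.comp ((hh.differentiable (by simp)) _).hasDerivAt)
  have h2 := (HasPartialAt.lower (hasPartialAt_retR hZ hX μ) α).mul
    ((hξ.comp ((hh'.differentiable (by simp)) _).hasDerivAt).mul (hasPartialAt_gradXi hZ hX μ))
  refine ((h1.add h2).const_mul (e / 2)).congr_value ?_
  rw [hessPhi, lower_sub, lower_smul, lower_smul]
  ring

/-- `□ Φ_α = Λ_α h(ξ̃) + Ψ_α`, pointwise. -/
lemma sum_metricSign_mul_hessPhi (hZ : IsWorldLine Z) (hX : X ∈ retardedDomain Z hZ) (h : ℝ → ℝ)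
    (e : ℝ) (α : Fin 4) : ∑ μ, metricSign μ * hessPhi e Z h α μ X =
      lienardWiechert e Z α X * h (retXi Z X) + psiOf e Z h α X := by
  have hpos := retXi_pos hZ hX
  have hR : lower (retR Z X) α = retXi Z X * lower (retK Z X) α := by
    rw [retK, lower_smul, mul_inv_cancel_left₀ hpos.ne']
  have hB : lorentz (deriv (deriv Z) (retardedTime Z X)) (retR Z X) =
      retXi Z X * retKappa Z X := by
    rw [retKappa, retK, lorentz_smul_right, mul_inv_cancel_left₀ hpos.ne']
  have s1 := (sum_metricSign_mul_lower (retK Z X) (retK Z X)).trans (lorentz_retK_retK hZ hX)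
  have s2 := (sum_metricSign_mul_lower (retVelocity Z X) (retK Z X)).trans
    (lorentz_retVelocity_retK hZ hX)
  have s3 := (sum_metricSign_mul_lower (retVelocity Z X) (retVelocity Z X)).trans
    (hZ.eigentime _)
  have s4 := (sum_metricSign_mul_lower (deriv (deriv Z) (retardedTime Z X)) (retK Z X))
  have s5 : ∑ μ, metricSign μ * metricSign μ = 4 := by simp [metricSign_mul_self]
  have s6 : ∑ μ, metricSign μ * (lower (Pi.single μ 1) α * gradXi Z μ X) = gradXi Z α X := by
    rw [Finset.sum_eq_single α]
    · simp [_root_.lower, ← mul_assoc, metricSign_mul_self]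
    · intro μ _ hμ
      simp [_root_.lower, hμ.symm]
    · simp
  change _ = retKappa Z X at s4
  have g (μ) : gradXi Z μ X = (retXi Z X * retKappa Z X - 1) * lower (retK Z X) μ +
    lower (retVelocity Z X) μ := by rw [gradXi, hB]
  -- The four contractions needed are `K̃·∂ξ̃ = 1`, `∂ξ̃·∂ξ̃ = 2ξ̃κ̃ - 1`, `∂·K̃ = 2/ξ̃` and `□ξ̃ =
  -- 4κ̃ - 2/ξ̃`.
  have t1 : ∑ μ, metricSign μ * (lower (retK Z X) μ * gradXi Z μ X) = 1 := by
    simp only [g, Fin.sum_univ_four] at s1 s2 ⊢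
    linear_combination (retXi Z X * retKappa Z X - 1) * s1 + s2
  have t2 : ∑ μ, metricSign μ * (gradXi Z μ X * gradXi Z μ X) =
      2 * (retXi Z X * retKappa Z X) - 1 := by
    simp only [g, Fin.sum_univ_four] at s1 s2 s3 ⊢
    linear_combination (retXi Z X * retKappa Z X - 1) ^ 2 * s1 +
      2 * (retXi Z X * retKappa Z X - 1) * s2 + s3
  have t3 : ∑ μ, metricSign μ * gradK Z μ X = 2 / retXi Z X := by
    simp only [gradK, Fin.sum_univ_four] at s2 s5 t1 ⊢
    field_simp
    linear_combination s5 - s2 - t1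
  have t4 : ∑ μ, metricSign μ * hessXi Z μ X = 4 * retKappa Z X - 2 / retXi Z X := by
    simp only [hessXi, hB, Fin.sum_univ_four] at s1 s4 t3 ⊢
    -- The third derivative of `Z` and the product `Z̈·Ż` occur only in the factor of `K̃_μ K̃_μ`,
    -- which contracts to `K̃² = 0`; their values are irrelevant.
    generalize lorentz _ _ - lorentz _ _ = C
    have : (retXi Z X * retKappa Z X - 1) * (2 / retXi Z X) = 2 * retKappa Z X - 2 / retXi Z X := by
      field_simp
    linear_combination C * s1 + 2 * s4 + (retXi Z X * retKappa Z X - 1) * t3 + this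
  have t5 : gradXi Z α X - lower (retVelocity Z X) α =
    (retXi Z X * retKappa Z X - 1) * lower (retK Z X) α := by rw [g]; ring
  simp only [hessPhi, lienardWiechert, psiOf, hR]
  clear g hR hB s2 s3 s4 s5
  simp only [Fin.sum_univ_four] at *
  have t6 : retXi Z X * (4 * retKappa Z X - 2 / retXi Z X) = 4 * (retXi Z X * retKappa Z X) - 2 := by
    field_simp
  rw [div_eq_mul_inv] at t3 t6 t4 ⊢
  -- The `h` terms give `Λ_α h` through `∂·K̃ = 2/ξ̃`, while `Z̈_α` is killed by `K̃² = 0`. The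
  -- coefficient `3ξ̃κ̃ - 2` of `h'` is `ξ̃κ̃ - 1` from the cross terms plus `2ξ̃κ̃ - 1` from `ξ̃
  -- □ξ̃ / 2`.
  linear_combination e / 2 * (- lower (retVelocity Z X) α * h (retXi Z X) * t3
    - lower (deriv (deriv Z) (retardedTime Z X)) α * h (retXi Z X) * s1
    + 2 * deriv h (retXi Z X) * (s6 - lower (retVelocity Z X) α * t1 + t5)
    + retXi Z X * lower (retK Z X) α * (deriv (deriv h) (retXi Z X) * t2
      + deriv h (retXi Z X) * t4) + lower (retK Z X) α * deriv h (retXi Z X) * t6)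

end RetardedDerivatives

/-! ### The generalized functions of the theorem -/

section Main

variable {Z : ℝ → Minkowski}

/-- `ξ̃` as an element of `C^∞(M)`. -/
def smoothXi (hZ : IsWorldLine Z) : smoothOn (retardedDomain Z hZ) :=
  ⟨retXi Z, contDiffOn_retXi hZ⟩

/-- The components of `K̃` as elements of `C^∞(M)`. -/
def smoothK (hZ : IsWorldLine Z) (μ : Fin 4) : smoothOn (retardedDomain Z hZ) :=
  ⟨fun X => retK Z X μ, contDiffOn_retK hZ μ⟩

/-- The coefficient `(e/2) R̃_α` of `Φ_α`. -/
def phiCoeff (hZ : IsWorldLine Z) (e : ℝ) (α : Fin 4) : smoothOn (retardedDomain Z hZ) :=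
  ⟨fun X => e / 2 * lower (retR Z X) α,
    contDiffOn_const.mul (contDiffOn_const.mul (contDiffOn_retR hZ α))⟩

/-- `Λ_α` as an element of `C^∞(M)`. -/
def smoothLienardWiechert (hZ : IsWorldLine Z) (e : ℝ) (α : Fin 4) :
    smoothOn (retardedDomain Z hZ) :=
  ⟨lienardWiechert e Z α,
    (contDiffOn_const.mul (contDiffOn_const.mul (contDiffOn_retVelocity hZ α))).div
      (contDiffOn_retXi hZ) fun _ hX => (retXi_pos hZ hX).ne'⟩

/-- The coefficient `e K̃_α (3 ξ̃ κ̃ - 2)` of `H'(ξ̃)` in `Ψ_α`. -/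
def psiCoeff₁ (hZ : IsWorldLine Z) (e : ℝ) (α : Fin 4) : smoothOn (retardedDomain Z hZ) :=
  ⟨fun X => e * lower (retK Z X) α * (3 * (retXi Z X * retKappa Z X) - 2),
    (contDiffOn_const.mul (contDiffOn_const.mul (contDiffOn_retK hZ α))).mul
      ((contDiffOn_const.mul ((contDiffOn_retXi hZ).mul (contDiffOn_retKappa hZ))).sub
        contDiffOn_const)⟩

/-- The coefficient `e K̃_α (ξ̃ κ̃ - 1/2) ξ̃` of `H''(ξ̃)` in `Ψ_α`. -/
def psiCoeff₂ (hZ : IsWorldLine Z) (e : ℝ) (α : Fin 4) : smoothOn (retardedDomain Z hZ) :=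
  ⟨fun X => e * lower (retK Z X) α * ((retXi Z X * retKappa Z X - 1 / 2) * retXi Z X),
    (contDiffOn_const.mul (contDiffOn_const.mul (contDiffOn_retK hZ α))).mul
      ((((contDiffOn_retXi hZ).mul (contDiffOn_retKappa hZ)).sub contDiffOn_const).mul
        (contDiffOn_retXi hZ))⟩

/-- The map `h ↦ Ψ_α`. -/
def psiMap (hZ : IsWorldLine Z) (e : ℝ) (α : Fin 4) :
    boundedSmooth →ₗ[ℝ] smoothOn (retardedDomain Z hZ) :=
  compMap (smoothXi hZ) (psiCoeff₁ hZ e α) 1 + compMap (smoothXi hZ) (psiCoeff₂ hZ e α) 2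

lemma psiMap_apply (hZ : IsWorldLine Z) (e : ℝ) (α : Fin 4) (h : boundedSmooth) :
    (psiMap hZ e α h).1 = psiOf e Z h.1 α := by
  funext X
  change e * lower (retK Z X) α * (3 * (retXi Z X * retKappa Z X) - 2) *
      iteratedDeriv 1 h.1 (retXi Z X) +
    e * lower (retK Z X) α * ((retXi Z X * retKappa Z X - 1 / 2) * retXi Z X) *
      iteratedDeriv 2 h.1 (retXi Z X) = _
  rw [psiOf, iteratedDeriv_succ (n := 1), iteratedDeriv_one]
  ring

lemma phiMap_apply (hZ : IsWorldLine Z) (e : ℝ) (α : Fin 4) (h : boundedSmooth) :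
    (compMap (smoothXi hZ) (phiCoeff hZ e α) 0 h).1 = phiOf e Z h.1 α := by
  funext X
  rw [compMap_apply, iteratedDeriv_zero]
  rfl

lemma Represents.representsOn {Ω : Opens Minkowski} {u : Ioc (0 : ℝ) 1 → smoothOn Ω}
    {U : Colombeau Ω} (hu : Represents (smoothOnSeminorm Ω) u U)
    {v : Ioc (0 : ℝ) 1 → Minkowski → ℝ} (h : ∀ ε, (u ε).1 = v ε) : RepresentsOn v U := by
  obtain rfl : (fun ε => (u ε).1) = v := funext h
  exact ⟨fun ε => (u ε).2, hu⟩

lemma Represents.colombeauDeriv {Ω : Opens Minkowski} {u : Ioc (0 : ℝ) 1 → smoothOn Ω}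
    {U : Colombeau Ω} (hu : Represents (smoothOnSeminorm Ω) u U) (μ : Fin 4) :
    Represents (smoothOnSeminorm Ω) (fun ε => partialDeriv Ω μ (u ε)) (colombeauDeriv Ω μ U) :=
  hu.generalizedMap _

lemma Represents.dAlembert {Ω : Opens Minkowski} {u : Ioc (0 : ℝ) 1 → smoothOn Ω}
    {U : Colombeau Ω} (hu : Represents (smoothOnSeminorm Ω) u U) :
    Represents (smoothOnSeminorm Ω)
      (fun ε => ∑ μ, metricSign μ • partialDeriv Ω μ (partialDeriv Ω μ (u ε)))
      (dAlembert Ω U) := by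
  have e : _root_.dAlembert Ω U =
      ∑ μ, metricSign μ • _root_.colombeauDeriv Ω μ (_root_.colombeauDeriv Ω μ U) := by
    simp [_root_.dAlembert, LinearMap.sum_apply]
  rw [e]
  exact Represents.sum Finset.univ fun μ _ =>
    ((hu.colombeauDeriv μ).colombeauDeriv μ).smul (metricSign μ)

lemma partialDeriv_partialDeriv_phiMap (hZ : IsWorldLine Z) (e : ℝ) (α μ : Fin 4)
    (h : boundedSmooth) {X : Minkowski} (hX : X ∈ retardedDomain Z hZ) :
    (partialDeriv _ μ (partialDeriv _ μ (compMap (smoothXi hZ) (phiCoeff hZ e α) 0 h))).1 X =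
      hessPhi e Z h.1 α μ X := by
  rw [partialDeriv_apply μ _ hX]
  refine ((hasPartialAt_gradPhi hZ hX h.2.1 e α μ).congr_of_eventuallyEq ?_).2
  filter_upwards [(retardedDomain Z hZ).isOpen.mem_nhds hX] with Y hY
  rw [partialDeriv_apply μ _ hY, phiMap_apply]
  exact (hasPartialAt_phiOf hZ hY (h.2.1.differentiable (by simp)) e α μ).2

/-- Agreement on the domain is all one can expect, since `partialDeriv` is cut off to zero outside;
it suffices for equality of generalized functions. -/
lemma dAlembert_phiMap_eqOn (hZ : IsWorldLine Z) (e : ℝ) (α : Fin 4) (h : boundedSmooth) :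
    EqOn (∑ μ, metricSign μ • partialDeriv _ μ (partialDeriv _ μ
        (compMap (smoothXi hZ) (phiCoeff hZ e α) 0 h)) : smoothOn (retardedDomain Z hZ)).1
      (compMap (smoothXi hZ) (smoothLienardWiechert hZ e α) 0 h + psiMap hZ e α h).1
      (retardedDomain Z hZ) := by
  intro X hX
  have hX' : X ∈ retardedDomain Z hZ := hX
  simp only [Submodule.coe_sum, Submodule.coe_smul, Finset.sum_apply, Pi.smul_apply, smul_eq_mul,
    Submodule.coe_add, Pi.add_apply, psiMap_apply]
  rw [compMap_apply, iteratedDeriv_zero]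
  exact (Finset.sum_congr rfl fun μ _ => by
    rw [partialDeriv_partialDeriv_phiMap hZ e α μ h hX']).trans
      (sum_metricSign_mul_hessPhi hZ hX' h.1 e α)

/-- Nets of the form `Ψ_α` are, as distributions, of the form `φ ↦ ∫ h(ξ̃) χ` with `∫ χ = 0`. -/
lemma exists_integral_psi_eq (hZ : IsWorldLine Z) (e : ℝ) (α : Fin 4)
    (φ : 𝓓(retardedDomain Z hZ, ℝ)) : ∃ χ : 𝓓(retardedDomain Z hZ, ℝ), ∫ x, χ x = 0 ∧
      ∀ h : boundedSmooth, ∫ x, (psiMap hZ e α h).1 x * φ x = ∫ x, h.1 (retXi Z x) * χ x := by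
  have hξ := contDiffOn_retXi hZ
  have hK : ∀ x ∈ retardedDomain Z hZ, fderiv ℝ (retXi Z) x (fun μ => (smoothK hZ μ).1 x) = 1 :=
    fun x hx => fderiv_retXi_retK hZ hx
  set φ₁ := mulTest (psiCoeff₁ hZ e α) φ
  set φ₂ := mulTest (psiCoeff₂ hZ e α) φ
  -- With `T` for `transposeDeriv`: `∫ h''(ξ̃) φ₂ = -∫ h'(ξ̃) T φ₂`, so the total is `-∫ h'(ξ̃) (T
  -- φ₂ - φ₁) = ∫ h(ξ̃) T(T φ₂ - φ₁)`.
  refine ⟨transposeDeriv (smoothK hZ) (transposeDeriv (smoothK hZ) φ₂ - φ₁),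
    integral_transposeDeriv hξ hK _, fun h => ?_⟩
  have d (k : ℕ) (s : ℝ) : HasDerivAt (iteratedDeriv k h.1) (iteratedDeriv (k + 1) h.1 s) s := by
    rw [iteratedDeriv_succ]
    exact ((contDiff_iteratedDeriv h k).differentiable (by simp) s).hasDerivAt
  have c (k : ℕ) : Continuous (iteratedDeriv k h.1) := (contDiff_iteratedDeriv h k).continuous
  have i (k : ℕ) (ψ : 𝓓(retardedDomain Z hZ, ℝ)) :
      Integrable fun x => iteratedDeriv k h.1 (retXi Z x) * ψ x :=
    integrable_mul_test (f := fun x => iteratedDeriv k h.1 (retXi Z x))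
      ((c k).comp_continuousOn hξ.continuousOn) ψ
  have e2 := integral_comp_mul_transposeDeriv hξ hK (d 1) (c 2) φ₂
  have e1 := integral_comp_mul_transposeDeriv hξ hK (d 0) (c 1)
    (transposeDeriv (smoothK hZ) φ₂ - φ₁)
  simp only [iteratedDeriv_zero] at e1
  rw [← neg_inj, ← e1]
  have e3 (x : Minkowski) : (psiMap hZ e α h).1 x * φ x =
      iteratedDeriv 1 h.1 (retXi Z x) * φ₁ x + iteratedDeriv 2 h.1 (retXi Z x) * φ₂ x := by
    change (_ * iteratedDeriv 1 h.1 (retXi Z x) + _ * iteratedDeriv 2 h.1 (retXi Z x)) * φ x =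
      _ * (_ * φ x) + _ * (_ * φ x)
    ring
  simp only [e3, sub_apply, mul_sub]
  rw [integral_add (i 1 _) (i 2 _), integral_sub (i 1 _) (i 1 _), e2]
  ring

end Main

end

theorem mainTheorem2 (Z : ℝ → Minkowski) (hZ : IsWorldLine Z) (e : ℝ)
    (H : GeneralizedFunction boundedSmoothSeminorm)
    (hH : IsAssociated boundedSmoothSeminorm boundedSmoothToDistribution H
      (regularDistribution ⊤ heaviside)) :
    -- the retarded proper time is unique, and it exists off the world line whenever every
    -- backward light cone (with its apex) meets the world line
    (∀ X ∈ retardedDomain Z hZ, ∃! τ, IsRetardedTime Z X τ) ∧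
    ((∀ X, ∃ τ, lorentz (X - Z τ) (X - Z τ) = 0 ∧ 0 ≤ (X - Z τ) 0) →
      (retardedDomain Z hZ : Set Minkowski) = (range Z)ᶜ) ∧
    -- the retarded distance is a smooth positive submersion
    ContDiffOn ℝ ∞ (retXi Z) (retardedDomain Z hZ) ∧
    (∀ X ∈ retardedDomain Z hZ, 0 < retXi Z X ∧ fderiv ℝ (retXi Z) X ≠ 0) ∧
    -- the generalized functions `H(ξ̃)`, `Φ_α`, `Λ_α H(ξ̃)`, `Ψ_α`, and their associations
    ∃ (HX : Colombeau (retardedDomain Z hZ))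
      (Φ LH Ψ : Fin 4 → Colombeau (retardedDomain Z hZ)),
      (∀ h, Represents boundedSmoothSeminorm h H →
        RepresentsOn (fun ε X => (h ε).1 (retXi Z X)) HX ∧
        ∀ α,
          RepresentsOn (fun ε => phiOf e Z (h ε).1 α) (Φ α) ∧
          RepresentsOn (fun ε X => lienardWiechert e Z α X * (h ε).1 (retXi Z X)) (LH α) ∧
          RepresentsOn (fun ε => psiOf e Z (h ε).1 α) (Ψ α)) ∧
      AssociatedOn HX (fun _ => 1) ∧
      ∀ α,
        dAlembert (retardedDomain Z hZ) (Φ α) = LH α + Ψ α ∧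
        AssociatedOn (LH α) (lienardWiechert e Z α) ∧
        AssociatedOn (Ψ α) (fun _ => 0) ∧
        AssociatedOn (dAlembert (retardedDomain Z hZ) (Φ α)) (lienardWiechert e Z α) := by
  set M := retardedDomain Z hZ
  have hξ := contDiffOn_retXi hZ
  have hK : ∀ x ∈ M, fderiv ℝ (retXi Z) x (fun μ => (smoothK hZ μ).1 x) = 1 :=
    fun x hx => fderiv_retXi_retK hZ hx
  have hpos : ∀ x ∈ M, 0 < retXi Z x := fun x hx => retXi_pos hZ hx
  let one : smoothOn M := ⟨fun _ => 1, contDiffOn_const⟩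
  have bH := finsetBounded_compMap (smoothXi hZ) one 0
  have bΦ (α) := finsetBounded_compMap (smoothXi hZ) (phiCoeff hZ e α) 0
  have bL (α) := finsetBounded_compMap (smoothXi hZ) (smoothLienardWiechert hZ e α) 0
  have bΨ (α) : FinsetBounded boundedSmoothSeminorm (smoothOnSeminorm M) (psiMap hZ e α) :=
    (finsetBounded_compMap _ _ _).add (finsetBounded_compMap _ _ _)
  obtain ⟨h, hh⟩ := exists_represents H
  have hlim (φ : 𝓓(M, ℝ)) : Tendsto (fun ε => ∫ x, (h ε).1 (retXi Z x) * φ x) epsToZero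
      (𝓝 (∫ x, φ x)) := tendsto_integral_comp_mul_test hξ hK hpos (hH h hh) φ
  have limL (α) (φ : 𝓓(M, ℝ)) : Tendsto (fun ε => ∫ x,
      (compMap (smoothXi hZ) (smoothLienardWiechert hZ e α) 0 (h ε)).1 x * φ x) epsToZero
      (𝓝 (∫ x, lienardWiechert e Z α x * φ x)) := by
    refine (hlim (mulTest (smoothLienardWiechert hZ e α) φ)).congr fun ε => ?_
    refine integral_congr_ae (Eventually.of_forall fun x => ?_)
    simp only [mulTest_apply, compMap_apply, iteratedDeriv_zero, smoothXi]
    ring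
  have limΨ (α) (φ : 𝓓(M, ℝ)) : Tendsto (fun ε => ∫ x, (psiMap hZ e α (h ε)).1 x * φ x)
      epsToZero (𝓝 0) := by
    -- The limit of `∫ h_ε(ξ̃) χ` is `∫ χ`, which is zero.
    obtain ⟨χ, h0, hχ⟩ := exists_integral_psi_eq hZ e α φ
    simp_rw [hχ, ← h0]
    exact hlim χ
  have cL (α) : ContinuousOn (lienardWiechert e Z α) M :=
    smoothOn.continuousOn (smoothLienardWiechert hZ e α)
  have box (α) : dAlembert M (inducedMap (bΦ α) H) = inducedMap (bL α) H + inducedMap (bΨ α) H :=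
    colombeau_eq_of_eqOn (hh.inducedMap (bΦ α)).dAlembert
      ((hh.inducedMap (bL α)).add (hh.inducedMap (bΨ α)))
      fun ε => dAlembert_phiMap_eqOn hZ e α (h ε)
  refine ⟨fun X hX => ⟨_, isRetardedTime_retardedTime hZ hX, fun τ hτ =>
      hτ.unique hZ (isRetardedTime_retardedTime hZ hX)⟩, retardedDomain_eq_compl_range hZ, hξ,
    fun X hX => ⟨hpos X hX, fun h0 => ?_⟩, inducedMap bH H, fun α => inducedMap (bΦ α) H,
    fun α => inducedMap (bL α) H, fun α => inducedMap (bΨ α) H, 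
    fun g hg => ⟨?_, fun α => ⟨?_, ?_, ?_⟩⟩,
    ?_, fun α => ⟨box α, ?_, ?_, ?_⟩⟩
  -- The gradient of `ξ̃` cannot vanish, since it takes the value `1` on `K̃`.
  · have := hK X hX
    simp [h0] at this
  · refine (hg.inducedMap bH).representsOn fun ε => funext fun X => ?_
    rw [compMap_apply, iteratedDeriv_zero]
    exact one_mul _
  · exact (hg.inducedMap (bΦ α)).representsOn fun ε => phiMap_apply hZ e α (g ε)
  · refine (hg.inducedMap (bL α)).representsOn fun ε => funext fun X => ?_
    rw [compMap_apply, iteratedDeriv_zero]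
    rfl
  · exact (hg.inducedMap (bΨ α)).representsOn fun ε => psiMap_apply hZ e α (g ε)
  · refine associatedOn_of_represents (hh.inducedMap bH) continuousOn_const fun φ => ?_
    simpa [compMap_apply, one, smoothXi] using hlim φ
  · exact associatedOn_of_represents (hh.inducedMap (bL α)) (cL α) (limL α)
  · refine associatedOn_of_represents (hh.inducedMap (bΨ α)) continuousOn_const fun φ => ?_
    simpa using limΨ α φ
  · rw [box α]
    refine associatedOn_of_represents ((hh.inducedMap (bL α)).add (hh.inducedMap (bΨ α))) (cL α)
      fun φ => ?_
    rw [← add_zero (∫ x, lienardWiechert e Z α x * φ x)]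
    refine ((limL α φ).add (limΨ α φ)).congr fun ε => ?_
    rw [← integral_add (integrable_mul_test (smoothOn.continuousOn _) φ)
      (integrable_mul_test (smoothOn.continuousOn _) φ)]
    refine integral_congr_ae (Eventually.of_forall fun x => ?_)
    simp only [Submodule.coe_add, Pi.add_apply, add_mul]
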